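/- Let $n_0,\dots,n_p$ be positive integers ($p\ge 0$), $n=n_0+\cdots+n_p$, and let $b,c$ be nonnegative integers. Let $N_l=\{n_0+\cdots+n_{l-1}+1,\dots,n_0+\cdots+n_l\}$ for $0\le l\le p$, and put $\varepsilon_{ij}=1$ if $\{i,j\}\subseteq N_l$ for some $l\in\{1,\dots,p\}$ and $\varepsilon_{ij}=0$ otherwise. Let $K$ be a field and let $q\in K$ be nonzero and not a root of unity. For $z\ge 0$ write $(y)_z=\prod_{j=0}^{z-1}(1-yq^j)$, and $(y)_{-d}=1/(yq^{-d})_d$ for $d>0$. For $a\in\mathbb{Z}$ let $$D_n(a)=\operatorname*{CT}_{x_1,\dots,x_n}\ \prod_{i=1}^{n}(x_0/x_i)_a(qx_i/x_0)_b\prod_{1\le i<j\le n}(x_i/x_j)_{c+\varepsilon_{ij}}(qx_j/x_i)_{c+\varepsilon_{ij}},$$ the constant term in $x_1,\dots,x_n$, taken in the field $K((x_n))((x_{n-1}))\cdots((x_0))$ of iterated Laurent series (for $a\ge 0$ this is the constant term of a Laurent polynomial). Let $n_{s_1}\le\cdots\le n_{s_p}$ be a rearrangement of $n_1,\dots,n_p$,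 and put $n_{s_0}=1$. Let $R$ be the union of the sets $$R^0_i=\{ic+1,\dots,ic+b\},\qquad 0\le i\le n_0+p-1,$$ and, for $1\le j\le p$, of the sets $$R^j_i=\{ic+t+1,\dots,ic+t+b\},\qquad t=\Big\lfloor\frac{i-n_0-\sum_{k=1}^{j-1}n_{s_k}}{p-j+1}\Big\rfloor,$$ for $n-\sum_{k=j}^{p}n_{s_k}+(p-j+1)n_{s_{j-1}}\le i\le n-\sum_{k=j+1}^{p}n_{s_k}+(p-j)n_{s_j}-1$. Then: (i) there is a polynomial $P\in K[z]$ of degree at most $nb$ such that $D_n(a)=P(q^a)$ for all $a\in\mathbb{Z}$ (in particular $D_n(a)$ does not involve $x_0$), and $P(q^{a})=0$ whenever $-a\in R$; (ii) $D_n(a)=0$ for every integer $a$ with $-a\in R$; (iii) if $c\ge b$, then $R$ has exactly $nb$ elements. -/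

import Mathlib

open scoped Polynomial

namespace BakerForrester

/-- The field `K((x_n))((x_{n-1}))⋯((x_0))` of iterated Laurent series: Hahn series whose exponents
`(e_0, …, e_n)` are ordered lexicographically, `x_0` being the most significant variable (a set of
exponents is well-ordered for this order iff it is the support of an iterated Laurent series, see
`HahnSeries.iterateEquiv`). -/
abbrev IterLaurent (K : Type*) [Zero K] (n : ℕ) : Type _ :=
  HahnSeries (Lex (Fin (n + 1) → ℤ)) K

/-- The variable `x_i`. -/
noncomputable def X (K : Type*) [Field K] {n : ℕ} (i : Fin (n + 1)) : IterLaurent K n :=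
  HahnSeries.single (toLex (Pi.single i (1 : ℤ))) 1

theorem apply_zero_monotone (n : ℕ) :
    Monotone fun γ : Lex (Fin (n + 1) → ℤ) => ofLex γ 0 := by
  intro γ δ h
  rcases h.eq_or_lt with rfl | ⟨i, hi, hlt⟩
  · exact le_rfl
  · rcases Fin.eq_zero_or_eq_succ i with rfl | ⟨j, rfl⟩
    · exact hlt.le
    · exact (hi 0 (Fin.succ_pos j)).le

/-- The constant term with respect to `x_1, …, x_n`: a Laurent series in `x_0`. -/
def CT {K : Type*} [Zero K] {n : ℕ} (f : IterLaurent K n) : LaurentSeries K where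
  coeff k := f.coeff (toLex (Pi.single 0 k))
  isPWO_support' := by
    refine (f.isPWO_support.image_of_monotone (apply_zero_monotone n)).mono ?_
    intro k hk
    exact ⟨toLex (Pi.single 0 k), hk, by simp⟩

/-- The `q`-shifted factorial `(y; q)_z = ∏_{j < z} (1 - y q ^ j)`, for `z` a natural number. -/
def qPochNat {F : Type*} [Field F] (q y : F) (z : ℕ) : F :=
  ∏ j ∈ Finset.range z, (1 - y * q ^ j)

/-- The `q`-shifted factorial `(y; q)_z` for an integer `z`, where
`(y; q)_{-d} = 1 / (y q ^ (-d); q)_d` for `d > 0`. -/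
def qPoch {F : Type*} [Field F] (q y : F) : ℤ → F
  | Int.ofNat z => qPochNat q y z
  | Int.negSucc z => (qPochNat q (y * q ^ (-((z : ℤ) + 1))) (z + 1))⁻¹

/-- `i ∈ N_l`, where `N_l = {n_0 + ⋯ + n_{l-1} + 1, …, n_0 + ⋯ + n_l}`. -/
def InBlock {p : ℕ} (m : Fin (p + 1) → ℕ) (l : Fin (p + 1)) (i : ℕ) : Prop :=
  ∑ k ∈ Finset.Iio l, m k < i ∧ i ≤ ∑ k ∈ Finset.Iic l, m k

open Classical in
/-- `ε_{ij}` is `1` if `{i, j} ⊆ N_l` for some `l ∈ {1, …, p}`, and `0` otherwise. -/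
noncomputable def eps {p : ℕ} (m : Fin (p + 1) → ℕ) (i j : ℕ) : ℕ :=
  if ∃ l : Fin (p + 1), l ≠ 0 ∧ InBlock m l i ∧ InBlock m l j then 1 else 0

/-- `L_{n_0, …, n_p}(a, b, c; x)` with `n = n_0 + ⋯ + n_p`, for an arbitrary integer `a`, expanded
as an iterated Laurent series. The indices `1, …, n` are `i.succ` for `i : Fin n`. -/
noncomputable def L {K : Type*} [Field K] (q : K) {p : ℕ} (m : Fin (p + 1) → ℕ)
    (a : ℤ) (b c : ℕ) : IterLaurent K (∑ l, m l) :=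
  let Q : IterLaurent K (∑ l, m l) := HahnSeries.C q
  let x : Fin (∑ l, m l + 1) → IterLaurent K (∑ l, m l) := X K
  (∏ i : Fin (∑ l, m l),
      qPoch Q (x 0 / x i.succ) a * qPochNat Q (Q * x i.succ / x 0) b) *
    ∏ i : Fin (∑ l, m l), ∏ j ∈ Finset.Ioi i,
      qPochNat Q (x i.succ / x j.succ) (c + eps m (i.succ : ℕ) (j.succ : ℕ)) *
        qPochNat Q (Q * x j.succ / x i.succ) (c + eps m (i.succ : ℕ) (j.succ : ℕ))

/-- `D_n((n_0, …, n_p); a, b, c)`, the constant term of `L` with respect to `x_1, …, x_n`. -/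
noncomputable def D {K : Type*} [Field K] (q : K) {p : ℕ} (m : Fin (p + 1) → ℕ)
    (a : ℤ) (b c : ℕ) : LaurentSeries K :=
  CT (L q m a b c)

/-- `n_{s_k}` for `1 ≤ k ≤ p`, with the convention `n_{s_0} = 1`
(and the unused value `0` for `k > p`). -/
def sortedSize {p : ℕ} (m : Fin (p + 1) → ℕ) (s : Equiv.Perm (Fin p)) : ℕ → ℤ
  | 0 => 1
  | k + 1 => if h : k < p then (m (s ⟨k, h⟩).succ : ℤ) else 0

/-- The set `R^0_i = {ic + 1, …, ic + b}`. -/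
def R0 (b c : ℕ) (i : ℤ) : Set ℤ :=
  Set.Icc (i * c + 1) (i * c + b)

/-- `⌊(i - n_0 - ∑_{k=1}^{j-1} n_{s_k}) / (p - j + 1)⌋` -/
def shift {p : ℕ} (m : Fin (p + 1) → ℕ) (s : Equiv.Perm (Fin p)) (j : ℕ) (i : ℤ) : ℤ :=
  ⌊((i - m 0 - ∑ k ∈ Finset.Ico 1 j, sortedSize m s k : ℤ) : ℚ) / ((p : ℚ) - j + 1)⌋

/-- The set `R^j_i`, for `1 ≤ j ≤ p`. -/
def Rj {p : ℕ} (m : Fin (p + 1) → ℕ) (s : Equiv.Perm (Fin p)) (b c : ℕ) (j : ℕ) (i : ℤ) :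
    Set ℤ :=
  Set.Icc (i * c + shift m s j i + 1) (i * c + shift m s j i + b)

/-- The set `R`: the union of the `R^0_i` for `0 ≤ i ≤ n_0 + p - 1` and, for `1 ≤ j ≤ p`, of the
`R^j_i` for `n - ∑_{k=j}^p n_{s_k} + (p-j+1) n_{s_{j-1}} ≤ i ≤
n - ∑_{k=j+1}^p n_{s_k} + (p-j) n_{s_j} - 1`. -/
def R {p : ℕ} (m : Fin (p + 1) → ℕ) (s : Equiv.Perm (Fin p)) (b c : ℕ) : Set ℤ :=
  (⋃ i ∈ Set.Icc (0 : ℤ) (m 0 + p - 1), R0 b c i) ∪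
    ⋃ j ∈ Set.Icc 1 p, ⋃ i ∈ Set.Icc
      (∑ l, (m l : ℤ) - ∑ k ∈ Finset.Icc j p, sortedSize m s k
        + ((p : ℤ) - j + 1) * sortedSize m s (j - 1))
      (∑ l, (m l : ℤ) - ∑ k ∈ Finset.Icc (j + 1) p, sortedSize m s k
        + ((p : ℤ) - j) * sortedSize m s j - 1),
      Rj m s b c j i

end BakerForrester

/-! Put z = q^a. As a power series in y = x_0/x_i, the factor (y;q)_a has coefficients polynomial in
z, the k-th of degree at most k (`qbinPoly`). In the variables x_i/x_0 the remaining factors form a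
polynomial F (`integrandPoly`) divided by a monomial with exponents d_i (`denomExp`). Hence the
constant term is the sum over the monomials κ of F of F_κ times the product of the coefficients of
index κ_i - d_i (`D_eq_pairing`). Since F has degree at most nb + ∑ d_i, this is a polynomial in z
of degree at most nb (`ctPoly`).

For a = -h with h ≥ 0, (y;q)_a generates the complete homogeneous symmetric polynomials in q^{-h},
..., q^{-1}. By Lagrange interpolation the one of degree k - d, taken on more than d nodes, is a
weighted sum of k-th powers of the nodes. The pairing is then a weighted sum of values of F on a
product of node sets, and it is zero if F vanishes there (`pairing_hSeries_eq_zero`). The h nodes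
alone may be too few, so nodes X q^t with t ≥ h and X an indeterminate are added; at X = 0 they drop
out. The enlarged pairing is a polynomial in X, and it suffices that it vanishes at X = q^v for all
v ≥ 0. Where F is nonzero, the exponents avoid -b, ..., -1 and are pairwise `Separated`.

No such grid point exists if ic + t + 1 ≤ h ≤ ic + t + b with i < n and t = `runOf m i`
(`no_separated_grid_point`). Sort exponents of one sign and subtract c times the position: the
result is weakly increasing, and along a constant stretch the blocks strictly increase, except that
N_0 may repeat. More than i negative exponents would need too much room (`IsSpaced.span_ge`); with
at most i of them, position i is nonnegative but is forced below h (`IsSpaced.le_of_lt_runStart`).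
The second bound is why the nodes in `removed` are omitted, few enough for interpolation to survive.
Finally R is the union of these intervals for h (`R_eq`), which are disjoint when b ≤ c. -/

namespace BakerForrester

/-! ### Combinatorics of spaced sequences labelled by blocks -/

section Chains

variable {p : ℕ}

/-- The largest number of elements that can be written as `t` successive increasing runs, each of
which uses every block other than the zeroth one at most once. -/
def runStart (m : Fin (p + 1) → ℕ) (t : ℕ) : ℕ :=
  m 0 + ∑ l : Fin p, min (m l.succ) t

/-- The number of blocks after `b` with more than `t` elements. -/
def bigAfter (m : Fin (p + 1) → ℕ) (t : ℕ) (b : Fin (p + 1)) : ℕ :=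
  (Finset.univ.filter fun l => b < l ∧ t < m l).card

/-- The size of a block, where the zeroth block is counted as if it were a singleton. -/
def effSize (m : Fin (p + 1) → ℕ) (b : Fin (p + 1)) : ℕ :=
  if b = 0 then 1 else m b

/-- The exponents which are left out of the interpolation grid of the variables in block `b`. -/
def removed (m : Fin (p + 1) → ℕ) (c M : ℕ) (b : Fin (p + 1)) : Finset ℤ :=
  (Finset.Ico (effSize m b) M).image fun t =>
    ((runStart m (t + 1) : ℤ) - 1 - bigAfter m t b) * c + t

/-- A sequence of integers, labelled by blocks and indexed by `[s, N)`, increasing by at least `c`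
in each step, and by more than `c` unless the block increases or both blocks are the zeroth one. -/
structure IsSpaced (c : ℕ) (s N : ℕ) (a : ℕ → ℤ) (B : ℕ → Fin (p + 1)) : Prop where
  step : ∀ k, s ≤ k → k + 1 < N → a k + c ≤ a (k + 1)
  tight : ∀ k, s ≤ k → k + 1 < N → a (k + 1) = a k + c →
    B k < B (k + 1) ∨ (B k = 0 ∧ B (k + 1) = 0)

variable {c s N : ℕ} {a : ℕ → ℤ} {B : ℕ → Fin (p + 1)}

theorem IsSpaced.le_of_le (h : IsSpaced c s N a B) {k k' : ℕ} (hs : s ≤ k) (hk : k ≤ k')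
    (hN : k' < N) : a k - k * c ≤ a k' - k' * c := by
  induction k', hk using Nat.le_induction with
  | base => exact le_rfl
  | succ j hj ih =>
    have h1 := ih (by omega)
    have h2 := h.step j (by omega) hN
    push_cast
    linarith

/-- The normalized values a k - k c are monotone, so equality at the ends makes every intermediate
step tight. -/
theorem IsSpaced.block_lt (h : IsSpaced c s N a B) {k k' : ℕ} (hs : s ≤ k) (hk : k < k')
    (hN : k' < N) (heq : a k - k * c = a k' - k' * c) :
    B k < B k' ∨ (B k = 0 ∧ B k' = 0) := by
  induction k', hk using Nat.le_induction with
  | base =>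
    refine h.tight k hs hN ?_
    push_cast at heq
    linarith
  | succ j hj ih =>
    have hj' : k < j := hj
    have h1 := h.le_of_le hs hj'.le (by omega)
    have h2 := h.le_of_le (k := j) (k' := j + 1) (by omega) (by omega) hN
    have h3 := ih (by omega) (by linarith)
    have h4 := h.tight j (by omega) hN (by push_cast at h2 heq; linarith)
    rcases h3 with h3 | ⟨h3, h3'⟩ <;> rcases h4 with h4 | ⟨h4, h4'⟩
    · exact Or.inl (h3.trans h4)
    · rw [h4] at h3; exact absurd h3 (Fin.not_lt_zero _)
    · rw [h3'] at h4; rw [h3]; exact Or.inl h4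
    · exact Or.inr ⟨h3, h4'⟩

/-- Otherwise the normalized values up to position i take at most t values. Each block other than
the zeroth uses a value at most once, so there are at most `runStart m t` positions. The case t = 0
is separate because `runStart m 0` is the size of N_0, not 0. -/
theorem IsSpaced.span_ge (h : IsSpaced c 0 N a B) (m : Fin (p + 1) → ℕ)
    (hcard : ∀ l, ((Finset.range N).filter fun k => B k = l).card ≤ m l)
    {i t : ℕ} (hi : i < N) (ht : t = 0 ∨ runStart m t ≤ i) :
    a 0 + i * c + t ≤ a i := by
  by_contra! hlt
  have hmono : ∀ k, k ≤ i → a 0 ≤ a k - k * c ∧ a k - k * c ≤ a i - i * c := fun k hk => by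
    have h1 := h.le_of_le le_rfl (Nat.zero_le k) (by omega)
    have h2 := h.le_of_le (Nat.zero_le k) hk hi
    simp only [Nat.cast_zero, zero_mul, sub_zero] at h1
    exact ⟨h1, h2⟩
  have ht0 : t ≠ 0 := by
    rintro rfl
    have := (hmono i le_rfl).1
    push_cast at hlt
    linarith
  have ht' := ht.resolve_left ht0
  have hsum : i + 1 = ∑ l, ((Finset.range (i + 1)).filter fun k => B k = l).card := by
    have := Finset.card_eq_sum_card_fiberwise (f := B) (s := Finset.range (i + 1))
      (t := Finset.univ) (fun _ _ => Finset.mem_coe.2 (Finset.mem_univ _))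
    simpa using this
  have hle : ∀ l, ((Finset.range (i + 1)).filter fun k => B k = l).card ≤ m l := fun l =>
    (Finset.card_le_card (Finset.filter_subset_filter _
      (Finset.range_subset_range.2 hi))).trans (hcard l)
  have hle' : ∀ l : Fin p,
      ((Finset.range (i + 1)).filter fun k => B k = l.succ).card ≤ t := by
    intro l
    have := Finset.card_le_card_of_injOn (s := (Finset.range (i + 1)).filter fun k => B k = l.succ)
      (t := Finset.Ico (a 0) (a 0 + t)) (fun k => a k - k * c) ?_ ?_
    · simpa using this
    · intro k hk
      simp only [Finset.coe_filter, Finset.mem_range, Set.mem_ofPred_eq] at hk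
      have := hmono k (by omega)
      simp only [Finset.coe_Ico, Set.mem_Ico]
      exact ⟨this.1, by linarith [this.2]⟩
    · intro k hk k' hk' heq
      simp only [Finset.coe_filter, Finset.mem_range, Set.mem_ofPred_eq] at hk hk'
      by_contra hne
      rcases lt_or_gt_of_ne hne with hlt | hlt
      · rcases h.block_lt (Nat.zero_le _) hlt (by omega) heq with h1 | ⟨h1, -⟩
        · rw [hk.2, hk'.2] at h1; exact lt_irrefl _ h1
        · rw [hk.2] at h1; exact Fin.succ_ne_zero _ h1
      · rcases h.block_lt (Nat.zero_le _) hlt (by omega) heq.symm with h1 | ⟨h1, -⟩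
        · rw [hk.2, hk'.2] at h1; exact lt_irrefl _ h1
        · rw [hk'.2] at h1; exact Fin.succ_ne_zero _ h1
  rw [Fin.sum_univ_succ] at hsum
  have : i + 1 ≤ runStart m t := by
    rw [hsum]
    exact add_le_add (hle 0) (Finset.sum_le_sum fun l _ => le_min (hle _) (hle' l))
  omega

theorem runStart_succ (m : Fin (p + 1) → ℕ) (t : ℕ) :
    runStart m (t + 1) = runStart m t + bigAfter m t 0 := by
  have : bigAfter m t 0 = ∑ l : Fin p, if t < m l.succ then 1 else 0 := by
    rw [bigAfter, Finset.card_filter, Fin.sum_univ_succ]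
    simp
  rw [runStart, runStart, this, add_assoc, ← Finset.sum_add_distrib]
  congr 1
  refine Finset.sum_congr rfl fun l _ => ?_
  split_ifs <;> omega

theorem runStart_mono (m : Fin (p + 1) → ℕ) : Monotone (runStart m) := fun _ _ h =>
  Nat.add_le_add_left (Finset.sum_le_sum fun _ _ => min_le_min_left _ h) _

theorem runStart_le_sum (m : Fin (p + 1) → ℕ) (t : ℕ) : runStart m t ≤ ∑ l, m l := by
  rw [Fin.sum_univ_succ]
  exact Nat.add_le_add_left (Finset.sum_le_sum fun _ _ => min_le_left _ _) _

theorem bigAfter_anti (m : Fin (p + 1) → ℕ) (t : ℕ) {b b' : Fin (p + 1)} (h : b ≤ b') :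
    bigAfter m t b' ≤ bigAfter m t b :=
  Finset.card_le_card (Finset.monotone_filter_right _ fun _ _ hl => ⟨h.trans_lt hl.1, hl.2⟩)

theorem bigAfter_lt (m : Fin (p + 1) → ℕ) (t : ℕ) {b b' : Fin (p + 1)} (h : b < b')
    (hb' : t < m b') : bigAfter m t b' < bigAfter m t b := by
  refine Finset.card_lt_card (Finset.ssubset_iff_of_subset
    (Finset.monotone_filter_right _ fun _ _ hl => ⟨h.trans hl.1, hl.2⟩) |>.2 ⟨b', ?_, ?_⟩)
  · simp [h, hb']
  · simp

/-- In a decreasing list of `g + 1` blocks, where `g` is the number of big blocks, some small block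
is preceded by exactly the right number of entries. -/
theorem exists_small_block (m : Fin (p + 1) → ℕ) (t : ℕ) (b : ℕ → Fin (p + 1))
    (hb : ∀ y, y + 1 ≤ bigAfter m t 0 → b (y + 1) < b y ∨ (b (y + 1) = 0 ∧ b y = 0)) :
    ∃ y ≤ bigAfter m t 0, bigAfter m t (b y) = y ∧ (b y = 0 ∨ m (b y) ≤ t) := by
  classical
  set g := bigAfter m t 0 with hg
  have hne : ((Finset.range (g + 1)).filter fun y => y ≤ bigAfter m t (b y)).Nonempty :=
    ⟨0, by simp⟩
  -- The largest y with y ≤ `bigAfter m t (b y)` works: passing to y + 1 must break the inequality,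
  -- which forces equality at y and excludes a big block there.
  obtain ⟨y, hy, hmax⟩ := Finset.exists_max_image _ id hne
  simp only [Finset.mem_filter, Finset.mem_range, id] at hy hmax
  have hle : bigAfter m t (b y) ≤ g := bigAfter_anti m t (Fin.zero_le _)
  rcases Nat.lt_or_ge y g with hyg | hyg
  · have h1 : bigAfter m t (b (y + 1)) ≤ y := by
      by_contra! h
      have := hmax (y + 1) ⟨by omega, h⟩
      omega
    have h2 : b (y + 1) ≤ b y := by
      rcases hb y hyg with h | ⟨h, h'⟩
      · exact h.le
      · rw [h, h']
    have h3 := bigAfter_anti m t h2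
    refine ⟨y, hyg.le, by omega, ?_⟩
    rcases hb y hyg with h | ⟨-, h'⟩
    · right
      by_contra! hbig
      have := bigAfter_lt m t h hbig
      omega
    · exact Or.inl h'
  · refine ⟨y, by omega, by omega, ?_⟩
    by_contra! h
    have := bigAfter_lt m t (Fin.pos_iff_ne_zero.2 h.1) h.2
    omega

/-- Descending induction on t from M, where the bound on the last entry suffices. A violation at t
pins the normalized value to t on g + 1 consecutive positions, where g counts the big blocks. The
blocks decrease there when read downwards, so some entry lands on an exponent removed for its block.
-/
theorem IsSpaced.le_of_lt_runStart (m : Fin (p + 1) → ℕ) {M : ℕ}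
    (h : IsSpaced c s (∑ l, m l) a B)
    (htop : ∀ k, s ≤ k → k < ∑ l, m l → a k ≤ ((∑ l, m l : ℕ) - 1 : ℤ) * c + M - 1)
    (hrem : ∀ k, s ≤ k → k < ∑ l, m l → a k ∉ removed m c M (B k)) {t : ℕ} (ht : 1 ≤ t)
    (htM : t ≤ M) {k : ℕ} (hs : s ≤ k) (hk : k < runStart m t) :
    a k ≤ k * c + t - 1 := by
  induction htM using Nat.decreasingInduction generalizing k with
  | self =>
    have hkn : k < ∑ l, m l := hk.trans_le (runStart_le_sum m _)
    have h1 := h.le_of_le hs (k' := ∑ l, m l - 1) (by omega) (by omega)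
    have h2 := htop (∑ l, m l - 1) (by omega) (by omega)
    rw [Nat.cast_sub (by omega)] at h1
    push_cast at h1 h2 ⊢
    linarith
  | of_succ t htM ih =>
    by_contra! hlt
    have hG := runStart_succ m t
    set g := bigAfter m t 0
    have hn := runStart_le_sum m (t + 1)
    -- The range begins at `runStart m t` - 1, one position early: this supplies the extra entry
    -- beyond the g big blocks.
    have hexact : ∀ j, runStart m t ≤ j + 1 → j < runStart m (t + 1) → a j = j * c + t := by
      intro j hj hj'
      have h1 := ih (by omega) (by omega) hj'
      have h2 := h.le_of_le hs (k' := j) (by omega) (by omega)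
      push_cast at h1
      linarith
    obtain ⟨y, hyg, hy, hsmall⟩ := exists_small_block m t
      (fun y => B (runStart m (t + 1) - 1 - y)) (fun y hy => by
        have e1 := hexact (runStart m (t + 1) - 1 - y) (by omega) (by omega)
        have e2 := hexact (runStart m (t + 1) - 1 - (y + 1)) (by omega) (by omega)
        have := h.block_lt (k := runStart m (t + 1) - 1 - (y + 1))
          (k' := runStart m (t + 1) - 1 - y) (by omega) (by omega) (by omega)
          (by rw [e1, e2]; ring)
        exact this)
    refine hrem (runStart m (t + 1) - 1 - y) (by omega) (by omega) ?_
    rw [removed, Finset.mem_image]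
    refine ⟨t, ?_, ?_⟩
    · rw [Finset.mem_Ico, effSize]
      refine ⟨?_, htM⟩
      split_ifs with h0
      · exact ht
      · exact hsmall.resolve_left h0
    · rw [hexact _ (by omega) (by omega), hy, Nat.cast_sub (by omega), Nat.cast_sub (by omega)]
      push_cast
      ring

end Chains

/-! ### From separated exponents to spaced sequences -/

section Sorting

variable {p n : ℕ}

/-- Two integer exponents `u`, `v`, belonging to indices `i < j`, are far enough from each other. -/
def Separated (z : ℕ) (u v : ℤ) : Prop :=
  u + z ≤ v ∨ v + z + 1 ≤ u

/-- `1` if the two blocks are equal and not the zeroth one, otherwise `0`. -/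
def sameBlock (b b' : Fin (p + 1)) : ℕ :=
  if b = b' ∧ b ≠ 0 then 1 else 0

/-- Sort by exponent, ties broken by index. Descending indices give a gap of at least c + 1; for
ascending indices a gap of exactly c excludes a common nonzeroth block, and monotonicity of `blk`
orders the blocks. -/
theorem exists_isSpaced {blk : Fin n → Fin (p + 1)} (hblk : Monotone blk) (c s : ℕ)
    (S : Finset (Fin n)) (α : Fin n → ℤ)
    (hsep : ∀ i ∈ S, ∀ j ∈ S, i < j →
      Separated (c + sameBlock (blk i) (blk j)) (α i) (α j)) :
    ∃ (a : ℕ → ℤ) (B : ℕ → Fin (p + 1)), IsSpaced c s (s + S.card) a B ∧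
      (∀ k, s ≤ k → k < s + S.card → ∃ j ∈ S, a k = α j ∧ B k = blk j) ∧
      ∀ l, ((Finset.Ico s (s + S.card)).filter fun k => B k = l).card ≤
        (S.filter fun j => blk j = l).card := by
  classical
  have hinj : Function.Injective fun j : Fin n => (toLex (α j, j) : ℤ ×ₗ Fin n) := fun j j' h =>
    (Prod.ext_iff.1 (toLex.injective h)).2
  set T : Finset (ℤ ×ₗ Fin n) := S.image fun j => toLex (α j, j) with hT
  have hcard : T.card = S.card := Finset.card_image_of_injective _ hinj
  set e := T.orderEmbOfFin hcard with he
  have hmem : ∀ k, ∃ j ∈ S, toLex (α j, j) = e k := fun k =>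
    Finset.mem_image.1 (T.orderEmbOfFin_mem hcard k)
  choose u huS hu using hmem
  have hmono : ∀ k k', k < k' → α (u k) < α (u k') ∨ (α (u k) = α (u k') ∧ u k < u k') := by
    intro k k' hk
    have := e.strictMono hk
    rw [← hu, ← hu, Prod.Lex.toLex_lt_toLex] at this
    exact this
  have huinj : Function.Injective u := by
    intro k k' h
    apply e.injective
    rw [← hu, ← hu, h]
  have key : ∀ k k', k < k' → α (u k) + c ≤ α (u k') ∧ (α (u k') = α (u k) + c →
      blk (u k) < blk (u k') ∨ (blk (u k) = 0 ∧ blk (u k') = 0)) := by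
    intro k k' hk
    have h1 := hmono k k' hk
    have hne : u k ≠ u k' := fun h => hk.ne (huinj h)
    rcases lt_or_gt_of_ne hne with hlt | hlt
    · have h2 := hsep _ (huS k) _ (huS k') hlt
      have h3 : α (u k) + (c + sameBlock (blk (u k)) (blk (u k')) : ℕ) ≤ α (u k') := by
        rcases h2 with h2 | h2
        · exact h2
        · push_cast at h2
          omega
      push_cast at h3
      refine ⟨by omega, fun heq => ?_⟩
      have h4 : sameBlock (blk (u k)) (blk (u k')) = 0 := by omega
      rcases (hblk hlt.le).lt_or_eq with h5 | h5
      · exact Or.inl h5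
      · right
        rw [sameBlock] at h4
        have : blk (u k) = 0 := by
          by_contra h0
          rw [if_pos ⟨h5, h0⟩] at h4
          omega
        exact ⟨this, h5 ▸ this⟩
    · have h2 := hsep _ (huS k') _ (huS k) hlt
      rcases h2 with h2 | h2 <;> push_cast at h2
      · omega
      · exact ⟨by omega, fun _ => by omega⟩
  refine ⟨fun k => if h : k - s < S.card then α (u ⟨k - s, h⟩) else 0,
    fun k => if h : k - s < S.card then blk (u ⟨k - s, h⟩) else 0, ⟨?_, ?_⟩, ?_, ?_⟩
  · intro k hs hk
    simp only [dif_pos (show k - s < S.card by omega), dif_pos (show k + 1 - s < S.card by omega)]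
    exact (key _ _ (by simp; omega)).1
  · intro k hs hk
    simp only [dif_pos (show k - s < S.card by omega), dif_pos (show k + 1 - s < S.card by omega)]
    exact (key _ _ (by simp; omega)).2
  · intro k hs hk
    simp only [dif_pos (show k - s < S.card by omega)]
    exact ⟨_, huS _, rfl, rfl⟩
  · intro l
    have hsub : ((Finset.Ico s (s + S.card)).filter fun k =>
        (if h : k - s < S.card then blk (u ⟨k - s, h⟩) else 0) = l) ⊆
        (Finset.univ.filter fun k : Fin S.card => blk (u k) = l).image fun k => k.1 + s := by
      intro k hk
      simp only [Finset.mem_filter, Finset.mem_Ico] at hk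
      rw [dif_pos (show k - s < S.card by omega)] at hk
      exact Finset.mem_image.2 ⟨⟨k - s, by omega⟩, by simpa using hk.2, by simp; omega⟩
    refine (Finset.card_le_card hsub).trans (Finset.card_image_le.trans ?_)
    refine Finset.card_le_card_of_injOn u (fun k hk => ?_) huinj.injOn
    simp only [Finset.coe_filter, Finset.mem_univ, true_and, Set.mem_ofPred_eq] at hk ⊢
    exact ⟨huS k, hk⟩

/-- There are no pairwise separated exponents in the interpolation grid. -/
theorem no_separated_grid_point (m : Fin (p + 1) → ℕ) {blk : Fin (∑ l, m l) → Fin (p + 1)}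
    (hblk : Monotone blk) (hcard : ∀ l, (Finset.univ.filter fun j => blk j = l).card ≤ m l)
    {b c M i t : ℕ} {h : ℤ} (hi : t = 0 ∨ runStart m t ≤ i) (hi' : i < runStart m (t + 1))
    (htM : t + 1 ≤ M) (hh : (i : ℤ) * c + t + 1 ≤ h) (hh' : h ≤ i * c + t + b)
    (τ : Fin (∑ l, m l) → ℤ)
    (hτ : ∀ j, (-h ≤ τ j ∧ τ j < -b) ∨
      (h ≤ τ j ∧ τ j ≤ ((∑ l, m l : ℕ) - 1 : ℤ) * c + M - 1 ∧ τ j ∉ removed m c M (blk j)))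
    (hsep : ∀ j j', j < j' → (0 ≤ τ j ↔ 0 ≤ τ j') →
      Separated (c + sameBlock (blk j) (blk j')) (τ j) (τ j')) : False := by
  classical
  have hpos : 0 < h := by
    have : (0 : ℤ) ≤ (i : ℤ) * c + t := by positivity
    omega
  set S := Finset.univ.filter fun j => τ j < 0 with hS
  set S' := Finset.univ.filter fun j => ¬ τ j < 0 with hS'
  have hSS' : S.card + S'.card = ∑ l, m l := by
    rw [hS, hS', Finset.card_filter_add_card_filter_not, Finset.card_univ, Fintype.card_fin]
  -- The first i + 1 negative exponents would span at least ic + t, but they lie in [-h, -b-1], of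
  -- length h - b - 1 < ic + t.
  have h1 : S.card ≤ i := by
    by_contra! hlt
    obtain ⟨a, B, hsp, hmem, hc⟩ := exists_isSpaced hblk c 0 S τ (fun j hj j' hj' hlt => by
      simp only [hS, Finset.mem_filter, Finset.mem_univ, true_and] at hj hj'
      exact hsep j j' hlt (by omega))
    rw [zero_add] at hsp hmem hc
    have hge := hsp.span_ge m (fun l => by
      rw [Finset.range_eq_Ico]
      exact (hc l).trans ((Finset.card_le_card
        (Finset.filter_subset_filter _ (Finset.subset_univ _))).trans (hcard l))) hlt hi
    obtain ⟨j, hj, hja, -⟩ := hmem 0 le_rfl (by omega)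
    obtain ⟨j', hj', hja', -⟩ := hmem i (Nat.zero_le _) hlt
    simp only [hS, Finset.mem_filter, Finset.mem_univ, true_and] at hj hj'
    have e1 := hτ j
    have e2 := hτ j'
    omega
  have h2 : i < ∑ l, m l := hi'.trans_le (runStart_le_sum m _)
  -- The nonnegative exponents are placed at positions |S|, ..., n - 1, so that the last one has
  -- position n - 1. Position i is then at most ic + t < h, whereas all of them are at least h.
  have h3 : S'.card + i < ∑ l, m l := by
    by_contra! hge
    obtain ⟨a, B, hsp, hmem, hc⟩ := exists_isSpaced hblk c S.card S' τ
      (fun j hj j' hj' hlt => by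
        simp only [hS', Finset.mem_filter, Finset.mem_univ, true_and] at hj hj'
        exact hsep j j' hlt (by omega))
    rw [hSS'] at hsp hmem hc
    have hle := hsp.le_of_lt_runStart m (M := M) (t := t + 1) (k := i) (fun k hk hk' => ?_)
      (fun k hk hk' => ?_) (by omega) htM h1 hi'
    · obtain ⟨j, hj, hja, -⟩ := hmem i h1 h2
      simp only [hS', Finset.mem_filter, Finset.mem_univ, true_and] at hj
      have := hτ j
      push_cast at hle
      omega
    · obtain ⟨j, hj, hja, -⟩ := hmem k hk hk'
      simp only [hS', Finset.mem_filter, Finset.mem_univ, true_and] at hj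
      have := hτ j
      rw [hja]
      rcases this with h | h
      · omega
      · exact h.2.1
    · obtain ⟨j, hj, hja, hjb⟩ := hmem k hk hk'
      simp only [hS', Finset.mem_filter, Finset.mem_univ, true_and] at hj
      have := hτ j
      rw [hja, hjb]
      rcases this with h | h
      · omega
      · exact h.2.2
  omega

end Sorting

/-! ### Complete homogeneous symmetric polynomials and Lagrange interpolation -/

section Interpolation

/-- The generating function of the complete homogeneous symmetric polynomials in `v i`, `i ∈ s`. -/
noncomputable def hSeries {A ι : Type*} [CommRing A] (v : ι → A) (s : Finset ι) : PowerSeries A :=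
  ∏ i ∈ s, PowerSeries.mk fun k => v i ^ k

theorem one_sub_mul_mk_pow {A : Type*} [CommRing A] (a : A) :
    (1 - PowerSeries.C a * PowerSeries.X) * PowerSeries.mk (fun k => a ^ k) = 1 := by
  ext k
  rw [sub_mul, one_mul, mul_assoc, map_sub, PowerSeries.coeff_C_mul]
  rcases k with _ | k
  · simp
  · rw [PowerSeries.coeff_succ_X_mul, PowerSeries.coeff_mk, PowerSeries.coeff_mk,
      PowerSeries.coeff_one, if_neg (Nat.succ_ne_zero k)]
    ring

theorem coeff_zero_hSeries {A ι : Type*} [CommRing A] (v : ι → A) (s : Finset ι) :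
    PowerSeries.coeff 0 (hSeries v s) = 1 := by
  rw [PowerSeries.coeff_zero_eq_constantCoeff_apply, hSeries, map_prod]
  exact Finset.prod_eq_one fun i _ => by
    rw [← PowerSeries.coeff_zero_eq_constantCoeff_apply]; simp

theorem coeff_succ_hSeries_cons {A ι : Type*} [CommRing A] (v : ι → A) {a : ι} {s : Finset ι}
    (ha : a ∉ s) (k : ℕ) :
    PowerSeries.coeff (k + 1) (hSeries v (Finset.cons a s ha)) =
      v a * PowerSeries.coeff k (hSeries v (Finset.cons a s ha)) +
        PowerSeries.coeff (k + 1) (hSeries v s) := by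
  have h : (1 - PowerSeries.C (v a) * PowerSeries.X) * hSeries v (Finset.cons a s ha) =
      hSeries v s := by
    rw [hSeries, Finset.prod_cons, ← mul_assoc, one_sub_mul_mk_pow, one_mul, hSeries]
  rw [← h, sub_mul, one_mul, mul_assoc, map_sub, PowerSeries.coeff_C_mul,
    PowerSeries.coeff_succ_X_mul]
  ring

theorem map_hSeries {A A' ι : Type*} [CommRing A] [CommRing A'] (f : A →+* A') (v : ι → A)
    (s : Finset ι) : PowerSeries.map f (hSeries v s) = hSeries (fun i => f (v i)) s := by
  rw [hSeries, map_prod, hSeries]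
  refine Finset.prod_congr rfl fun i _ => ?_
  ext k
  simp

/-- The left side is the divided difference of x^r at the nodes. Both sides satisfy the same
recursion when a node is added and r is raised, so a double induction applies. -/
theorem sum_pow_div_eq_coeff_hSeries {K ι : Type*} [Field K] [DecidableEq ι] (v : ι → K)
    {s : Finset ι} (hs : s.Nonempty) (hv : Set.InjOn v s) (r : ℕ) :
    ∑ x ∈ s, v x ^ r / ∏ y ∈ s.erase x, (v x - v y) =
      if s.card ≤ r + 1 then PowerSeries.coeff (r + 1 - s.card) (hSeries v s) else 0 := by
  induction hs using Finset.Nonempty.cons_induction generalizing r with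
  | singleton a => simp [hSeries]
  | cons a s ha hs ih =>
    have hv' : Set.InjOn v s := hv.mono (by simp)
    have hpos := hs.card_pos
    induction r with
    | zero =>
      -- For r = 0 the sum is the coefficient of degree |s| (with |s| + 1 nodes) of the constant
      -- polynomial 1.
      have h := Lagrange.coeff_eq_sum hv (P := 1)
        (by rw [Polynomial.degree_one]; exact_mod_cast (Finset.cons_nonempty ha).card_pos)
      simp only [Polynomial.eval_one] at h
      simp only [pow_zero]
      rw [← h, Finset.card_cons, if_neg (by omega), Polynomial.coeff_one, if_neg (by omega)]
    | succ r ihr =>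
      have hrec : ∑ x ∈ Finset.cons a s ha, v x ^ (r + 1) /
            ∏ y ∈ (Finset.cons a s ha).erase x, (v x - v y) =
          v a * ∑ x ∈ Finset.cons a s ha, v x ^ r /
            ∏ y ∈ (Finset.cons a s ha).erase x, (v x - v y) +
          ∑ x ∈ s, v x ^ r / ∏ y ∈ s.erase x, (v x - v y) := by
        rw [← sub_eq_iff_eq_add', Finset.mul_sum, ← Finset.sum_sub_distrib, Finset.sum_cons]
        rw [pow_succ', mul_div_assoc, sub_self, zero_add]
        refine Finset.sum_congr rfl fun x hx => ?_
        have hxa : x ≠ a := fun h => ha (h ▸ hx)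
        have hne : v x - v a ≠ 0 := sub_ne_zero.2 fun h =>
          hxa (hv (by simp [hx]) (by simp) h)
        rw [Finset.cons_eq_insert, Finset.erase_insert_of_ne hxa.symm,
          Finset.prod_insert (by simp [ha]), pow_succ', mul_div_assoc, ← sub_mul, ← div_div,
          mul_div_assoc', mul_div_assoc', mul_div_cancel_left₀ _ hne]
      rw [hrec, ihr, ih hv', Finset.card_cons]
      rcases lt_trichotomy s.card (r + 1) with h | h | h
      · rw [if_pos (by omega), if_pos (by omega), if_pos (by omega),
          show r + 1 + 1 - (s.card + 1) = r - s.card + 1 by omega, coeff_succ_hSeries_cons,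
          show r + 1 - (s.card + 1) = r - s.card by omega,
          show r + 1 - s.card = r - s.card + 1 by omega]
      · rw [if_neg (by omega), if_pos (by omega), if_pos (by omega), h, Nat.sub_self,
          Nat.sub_self, coeff_zero_hSeries, coeff_zero_hSeries, mul_zero, zero_add]
      · rw [if_neg (by omega), if_neg (by omega), if_neg (by omega), mul_zero, zero_add]

/-- The coefficient of index `k - d`, which is `0` if this is negative. -/
noncomputable def coeffSub {A : Type*} [CommRing A] (f : PowerSeries A) (k d : ℕ) : A :=
  if d ≤ k then PowerSeries.coeff (k - d) f else 0

theorem map_coeffSub {A A' : Type*} [CommRing A] [CommRing A'] (φ : A →+* A')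
    (f : PowerSeries A) (k d : ℕ) : φ (coeffSub f k d) = coeffSub (PowerSeries.map φ f) k d := by
  simp only [coeffSub]
  split_ifs
  · rw [PowerSeries.coeff_map]
  · exact map_zero φ

/-- This is the divided difference of x^r with r = k + |s| - 1 - d. For k < d it is 0, because then
r < |s| - 1. The weights do not depend on k, which lets whole polynomials be evaluated at the nodes.
-/
theorem coeffSub_hSeries {K ι : Type*} [Field K] [DecidableEq ι] (v : ι → K)
    {s : Finset ι} (hv : Set.InjOn v s) {d : ℕ} (hd : d + 1 ≤ s.card) (k : ℕ) :
    coeffSub (hSeries v s) k d =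
      ∑ x ∈ s, v x ^ k * (v x ^ (s.card - 1 - d) / ∏ y ∈ s.erase x, (v x - v y)) := by
  have h := sum_pow_div_eq_coeff_hSeries v (Finset.card_pos.1 (by omega)) hv
    (k + (s.card - 1 - d))
  simp only [← mul_div_assoc, ← pow_add]
  rw [h, coeffSub]
  by_cases hdk : d ≤ k
  · rw [if_pos hdk, if_pos (by omega)]
    congr 2
    omega
  · rw [if_neg hdk, if_neg (by omega)]

/-- The pairing of a polynomial with power series `f i`, where the monomial `x ^ κ` is paired to
the product of the coefficients of index `κ i - d i`. -/
noncomputable def pairing {K A : Type*} [Field K] [CommRing A] [Algebra K A] {n : ℕ}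
    (F : MvPolynomial (Fin n) K) (d : Fin n → ℕ) (f : Fin n → PowerSeries A) : A :=
  ∑ κ ∈ F.support, algebraMap K A (F.coeff κ) * ∏ i, coeffSub (f i) (κ i) (d i)

theorem map_pairing {K A A' : Type*} [Field K] [CommRing A] [Algebra K A] [CommRing A']
    [Algebra K A'] {n : ℕ} (F : MvPolynomial (Fin n) K) (d : Fin n → ℕ)
    (f : Fin n → PowerSeries A) (φ : A →ₐ[K] A') :
    φ (pairing F d f) = pairing F d fun i => PowerSeries.map (φ : A →+* A') (f i) := by
  simp only [pairing, map_sum, map_mul, map_prod, AlgHom.commutes]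
  refine Finset.sum_congr rfl fun κ _ => congrArg _ (Finset.prod_congr rfl fun i _ => ?_)
  exact map_coeffSub (φ : A →+* A') _ _ _

/-- The pairing vanishes if the polynomial vanishes on a large enough grid. -/
theorem pairing_hSeries_eq_zero {K ι : Type*} [Field K] {n : ℕ}
    (F : MvPolynomial (Fin n) K) (d : Fin n → ℕ) (v : ι → K) (T : Fin n → Finset ι)
    (hv : ∀ i, Set.InjOn v (T i)) (hd : ∀ i, d i + 1 ≤ (T i).card)
    (hF : ∀ τ : Fin n → ι, (∀ i, τ i ∈ T i) → F.eval (fun i => v (τ i)) = 0) :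
    pairing F d (fun i => hSeries v (T i)) = 0 := by
  classical
  simp only [pairing, coeffSub_hSeries v (hv _) (hd _), Finset.prod_univ_sum, Finset.mul_sum]
  rw [Finset.sum_comm]
  refine Finset.sum_eq_zero fun τ hτ => ?_
  have h := hF τ (Fintype.mem_piFinset.1 hτ)
  rw [MvPolynomial.eval_eq'] at h
  simp only [Finset.prod_mul_distrib, ← mul_assoc]
  rw [← Finset.sum_mul]
  simp only [Algebra.algebraMap_self, RingHom.id_apply]
  rw [h, zero_mul]

end Interpolation

/-! ### The q-binomial series -/

section QBinomial

variable {K : Type*} [Field K]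

/-- The coefficient of `y ^ k` in `(y; q)_a` as a polynomial in `q ^ a`. -/
noncomputable def qbinPoly (q : K) (k : ℕ) : K[X] :=
  Polynomial.C (∏ j ∈ Finset.range k, (1 - q ^ (j + 1)))⁻¹ *
    ∏ j ∈ Finset.range k, (Polynomial.X - Polynomial.C (q ^ j))

/-- The power series of `(y; q)_a`, where `z = q ^ a`. -/
noncomputable def qbinSeries (q z : K) : PowerSeries K :=
  PowerSeries.mk fun k => (qbinPoly q k).eval z

theorem natDegree_qbinPoly_le (q : K) (k : ℕ) : (qbinPoly q k).natDegree ≤ k := by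
  refine (Polynomial.natDegree_C_mul_le _ _).trans ((Polynomial.natDegree_prod_le _ _).trans ?_)
  refine (Finset.sum_le_card_nsmul _ _ 1 fun j _ => ?_).trans (by simp)
  exact (Polynomial.natDegree_X_sub_C _).le

theorem eval_qbinPoly (q z : K) (k : ℕ) : (qbinPoly q k).eval z =
    (∏ j ∈ Finset.range k, (1 - q ^ (j + 1)))⁻¹ * ∏ j ∈ Finset.range k, (z - q ^ j) := by
  simp [qbinPoly, Polynomial.eval_prod]

theorem one_sub_pow_ne_zero {q : K} (hq : ∀ k : ℕ, 0 < k → q ^ k ≠ 1) (k : ℕ) :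
    1 - q ^ (k + 1) ≠ 0 :=
  sub_ne_zero.2 (hq _ k.succ_pos).symm

/-- The functional equation (y;q)_a (1 - q^a y) = (y;q)_{a+1}, checked coefficientwise for arbitrary
z in place of q^a. -/
theorem qbinSeries_mul {q : K} (hq : ∀ k : ℕ, 0 < k → q ^ k ≠ 1) (z : K) :
    qbinSeries q z * (1 - PowerSeries.C z * PowerSeries.X) = qbinSeries q (q * z) := by
  ext k
  rw [mul_sub, mul_one, mul_comm, mul_assoc, map_sub, PowerSeries.coeff_C_mul]
  rcases k with _ | k
  · simp [qbinSeries, eval_qbinPoly]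
  · rw [PowerSeries.coeff_succ_X_mul]
    simp only [qbinSeries, PowerSeries.coeff_mk, eval_qbinPoly]
    have h1 : ∏ j ∈ Finset.range (k + 1), (q * z - q ^ j) =
        (q * z - 1) * (q ^ k * ∏ j ∈ Finset.range k, (z - q ^ j)) := by
      rw [Finset.prod_range_succ', pow_zero, mul_comm]
      congr 1
      simp only [pow_succ', ← mul_sub, Finset.prod_mul_distrib, Finset.prod_const,
        Finset.card_range]
    rw [h1, Finset.prod_range_succ, Finset.prod_range_succ, mul_inv]
    have h2 := one_sub_pow_ne_zero hq k
    field_simp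
    ring

theorem qbinSeries_one (q : K) : qbinSeries q 1 = 1 := by
  ext k
  rcases k with _ | k
  · simp [qbinSeries, eval_qbinPoly]
  · rw [qbinSeries, PowerSeries.coeff_mk, eval_qbinPoly,
      Finset.prod_range_succ' (fun j => (1 : K) - q ^ j), PowerSeries.coeff_one,
      if_neg (Nat.succ_ne_zero k), pow_zero, sub_self, mul_zero, mul_zero]

theorem qbinSeries_mul_prod {q : K} (hq : ∀ k : ℕ, 0 < k → q ^ k ≠ 1) (z : K) (h : ℕ) :
    qbinSeries q z * ∏ j ∈ Finset.range h, (1 - PowerSeries.C (z * q ^ j) * PowerSeries.X) =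
      qbinSeries q (z * q ^ h) := by
  induction h with
  | zero => simp
  | succ h ih =>
    rw [Finset.prod_range_succ, ← mul_assoc, ih, qbinSeries_mul hq]
    congr 1
    ring

theorem qbinSeries_neg {q : K} (hq0 : q ≠ 0) (hq : ∀ k : ℕ, 0 < k → q ^ k ≠ 1) (h : ℕ) :
    qbinSeries q (q ^ (-h : ℤ)) = hSeries (fun t : ℤ => q ^ t) (Finset.Icc (-h : ℤ) (-1)) := by
  induction h with
  | zero => simp [qbinSeries_one, hSeries]
  | succ h ih =>
    have hins : Finset.Icc (-((h + 1 : ℕ) : ℤ)) (-1) =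
        insert (-((h + 1 : ℕ) : ℤ)) (Finset.Icc (-(h : ℤ)) (-1)) := by
      ext t
      simp only [Finset.mem_Icc, Finset.mem_insert]
      omega
    have hmul := qbinSeries_mul hq (q ^ (-((h + 1 : ℕ) : ℤ)))
    rw [← zpow_one_add₀ hq0, show 1 + -((h + 1 : ℕ) : ℤ) = -(h : ℤ) by push_cast; ring, ih] at hmul
    rw [hins, hSeries, Finset.prod_insert (by simp), ← hSeries, ← hmul, mul_left_comm,
      mul_comm (PowerSeries.mk _), one_sub_mul_mk_pow, mul_one]

theorem zpow_injective {q : K} (hq0 : q ≠ 0) (hq : ∀ k : ℕ, 0 < k → q ^ k ≠ 1) :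
    Function.Injective fun t : ℤ => q ^ t := by
  have key : ∀ s t : ℤ, s < t → q ^ s ≠ q ^ t := by
    intro s t hst heq
    obtain ⟨k, hk⟩ := Int.eq_ofNat_of_zero_le (sub_nonneg.2 hst.le)
    refine hq k (by omega) ?_
    rw [← zpow_natCast, ← hk, zpow_sub₀ hq0, heq, div_self (zpow_ne_zero _ hq0)]
  intro s t h
  rcases lt_trichotomy s t with hst | hst | hst
  · exact absurd h (key s t hst)
  · exact hst
  · exact absurd h.symm (key t s hst)

end QBinomial

/-! ### The integrand with denominators cleared, and its nonzero values -/

section Integrand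

variable {K : Type*} [Field K] {n : ℕ}

/-- The polynomial obtained from `∏ (q x_i)_b ∏ (x_i / x_j)_z (q x_j / x_i)_z` by clearing
denominators. -/
noncomputable def integrandPoly (q : K) (b : ℕ) (z : Fin n → Fin n → ℕ) : MvPolynomial (Fin n) K :=
  (∏ i, ∏ t ∈ Finset.range b, (1 - MvPolynomial.C (q ^ (t + 1)) * MvPolynomial.X i)) *
    ∏ i, ∏ j ∈ Finset.Ioi i, ∏ u ∈ Finset.range (z i j),
      (MvPolynomial.X j - MvPolynomial.C (q ^ u) * MvPolynomial.X i) *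
        (MvPolynomial.X i - MvPolynomial.C (q ^ (u + 1)) * MvPolynomial.X j)

/-- The exponent of `x_i` in the denominator of `∏ (x_i / x_j)_z (q x_j / x_i)_z`. -/
def denomExp (z : Fin n → Fin n → ℕ) (i : Fin n) : ℕ :=
  ∑ j ∈ Finset.Ioi i, z i j + ∑ j ∈ Finset.Iio i, z j i

theorem sum_denomExp (z : Fin n → Fin n → ℕ) :
    ∑ i, denomExp z i = ∑ i, ∑ j ∈ Finset.Ioi i, 2 * z i j := by
  have h : ∑ i, ∑ j ∈ Finset.Iio i, z j i = ∑ i, ∑ j ∈ Finset.Ioi i, z i j :=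
    Finset.sum_comm' (by simp)
  simp only [denomExp, Finset.sum_add_distrib, h, ← Finset.mul_sum]
  ring

theorem totalDegree_integrandPoly_le (q : K) (b : ℕ) (z : Fin n → Fin n → ℕ) :
    (integrandPoly q b z).totalDegree ≤ n * b + ∑ i, denomExp z i := by
  have hX : ∀ (a : K) (i : Fin n),
      (MvPolynomial.C a * MvPolynomial.X i : MvPolynomial (Fin n) K).totalDegree ≤ 1 := fun a i =>
    (MvPolynomial.totalDegree_mul _ _).trans (by simp)
  rw [sum_denomExp]
  refine (MvPolynomial.totalDegree_mul _ _).trans (add_le_add ?_ ?_)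
  · refine (MvPolynomial.totalDegree_finsetProd _ _).trans
      ((Finset.sum_le_card_nsmul _ _ b fun i _ => ?_).trans (by simp))
    refine (MvPolynomial.totalDegree_finsetProd _ _).trans
      ((Finset.sum_le_card_nsmul _ _ 1 fun t _ => ?_).trans (by simp))
    exact (MvPolynomial.totalDegree_sub _ _).trans (max_le (by simp) (hX _ _))
  · refine (MvPolynomial.totalDegree_finsetProd _ _).trans (Finset.sum_le_sum fun i _ => ?_)
    refine (MvPolynomial.totalDegree_finsetProd _ _).trans (Finset.sum_le_sum fun j _ => ?_)
    refine (MvPolynomial.totalDegree_finsetProd _ _).trans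
      ((Finset.sum_le_card_nsmul _ _ 2 fun u _ => ?_).trans (by simp [mul_comm]))
    refine (MvPolynomial.totalDegree_mul _ _).trans (add_le_add (b := 1) (d := 1) ?_ ?_) <;>
      exact (MvPolynomial.totalDegree_sub _ _).trans (max_le (by simp) (hX _ _))

theorem eval_integrandPoly (q : K) (b : ℕ) (z : Fin n → Fin n → ℕ) (x : Fin n → K) :
    (integrandPoly q b z).eval x =
      (∏ i, ∏ t ∈ Finset.range b, (1 - q ^ (t + 1) * x i)) *
        ∏ i, ∏ j ∈ Finset.Ioi i, ∏ u ∈ Finset.range (z i j),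
          (x j - q ^ u * x i) * (x i - q ^ (u + 1) * x j) := by
  simp [integrandPoly, map_prod]

/-- The factors x_j - q^u x_i exclude 0 ≤ σ j - σ i < z, and the factors x_i - q^(u+1) x_j exclude 1
≤ σ i - σ j ≤ z. -/
theorem separated_of_eval_ne_zero {q : K} (hq0 : q ≠ 0) {b : ℕ} {z : Fin n → Fin n → ℕ}
    {σ : Fin n → ℤ} (h : (integrandPoly q b z).eval (fun i => q ^ σ i) ≠ 0) :
    (∀ i, ¬ (-(b : ℤ) ≤ σ i ∧ σ i < 0)) ∧ ∀ i j, i < j → Separated (z i j) (σ i) (σ j) := by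
  rw [eval_integrandPoly] at h
  obtain ⟨h1, h2⟩ := mul_ne_zero_iff.1 h
  simp only [Finset.prod_ne_zero_iff, Finset.mem_univ, forall_true_left, Finset.mem_range,
    Finset.mem_Ioi, mul_ne_zero_iff] at h1 h2
  refine ⟨fun i hi => ?_, fun i j hij => ?_⟩
  · obtain ⟨t, ht⟩ := Int.eq_ofNat_of_zero_le (a := -σ i - 1) (by omega)
    refine h1 i t (by omega) ?_
    rw [← zpow_natCast, ← zpow_add₀ hq0, show ((t + 1 : ℕ) : ℤ) + σ i = 0 by push_cast; omega,
      zpow_zero, sub_self]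
  · by_contra hsep
    simp only [Separated, not_or, not_le] at hsep
    rcases le_or_gt (σ i) (σ j) with hle | hlt
    · obtain ⟨u, hu⟩ := Int.eq_ofNat_of_zero_le (sub_nonneg.2 hle)
      refine (h2 i j hij u (by omega)).1 ?_
      rw [← zpow_natCast, ← zpow_add₀ hq0, ← hu, sub_add_cancel, sub_self]
    · obtain ⟨u, hu⟩ := Int.eq_ofNat_of_zero_le (a := σ i - σ j - 1) (by omega)
      refine (h2 i j hij u (by omega)).2 ?_
      rw [← zpow_natCast, ← zpow_add₀ hq0,
        show ((u + 1 : ℕ) : ℤ) + σ j = σ i by push_cast; omega, sub_self]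

end Integrand

/-! ### Vanishing of the pairing by interpolation on an enlarged grid -/

section Vanishing

variable {K : Type*} [Field K] {p : ℕ}

/-- The set of exponents of the interpolation nodes for a variable in block `l`. -/
noncomputable def grid (m : Fin (p + 1) → ℕ) (c M h n : ℕ) (l : Fin (p + 1)) : Finset ℤ :=
  Finset.Icc (-h : ℤ) (-1) ∪
    (Finset.Icc (h : ℤ) (((n : ℕ) - 1 : ℤ) * c + M - 1) \ removed m c M l)

/-- Starting the second interval at h makes h cancel: it has at least (n - 1) c + M - h points, the
first has h, and at most M - `effSize m l` are removed. -/
theorem le_card_grid (m : Fin (p + 1) → ℕ) {c M h n : ℕ} {l : Fin (p + 1)} (hn : 0 < n)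
    (hM : effSize m l ≤ M) : (n - 1) * c + effSize m l ≤ (grid m c M h n l).card := by
  rw [grid, Finset.card_union_of_disjoint]
  · have h1 : (removed m c M l).card ≤ M - effSize m l := Finset.card_image_le.trans (by simp)
    have h2 := Finset.le_card_sdiff (removed m c M l)
      (Finset.Icc (h : ℤ) (((n : ℕ) - 1 : ℤ) * c + M - 1))
    rw [Int.card_Icc] at h2 ⊢
    have h3 : ((n : ℤ) - 1) * c = ((n - 1) * c : ℕ) := by
      rw [Nat.cast_mul, Nat.cast_sub hn, Nat.cast_one]
    rw [h3] at h2 ⊢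
    omega
  · refine Finset.disjoint_left.2 fun t ht ht' => ?_
    simp only [Finset.mem_Icc, Finset.mem_sdiff] at ht ht'
    omega

theorem pairing_qbinSeries_eq_zero {q : K} (hq0 : q ≠ 0) (hq : ∀ k : ℕ, 0 < k → q ^ k ≠ 1)
    (m : Fin (p + 1) → ℕ) {blk : Fin (∑ l, m l) → Fin (p + 1)} (hblk : Monotone blk)
    (hcard : ∀ l, (Finset.univ.filter fun j => blk j = l).card ≤ m l) (d : Fin (∑ l, m l) → ℕ)
    {b c M i t h : ℕ} (hd : ∀ j, d j + 1 ≤ (∑ l, m l - 1) * c + effSize m (blk j))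
    (hM : ∀ l, effSize m l ≤ M)
    (hi : t = 0 ∨ runStart m t ≤ i) (hi' : i < runStart m (t + 1))
    (htM : t + 1 ≤ M) (hh : (i : ℤ) * c + t + 1 ≤ h) (hh' : (h : ℤ) ≤ i * c + t + b) :
    pairing (integrandPoly q b fun j j' => c + sameBlock (blk j) (blk j')) d
      (fun _ => qbinSeries q (q ^ (-h : ℤ))) = 0 := by
  classical
  set F := integrandPoly q b fun j j' => c + sameBlock (blk j) (blk j') with hF
  set T : Fin (∑ l, m l) → Finset ℤ := fun j => grid m c M h (∑ l, m l) (blk j) with hT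
  have hn : 0 < ∑ l, m l := (Nat.zero_le i).trans_lt (hi'.trans_le (runStart_le_sum m _))
  -- The indeterminate deforms the auxiliary nodes: they are distinct at X = q^v and disappear at X
  -- = 0.
  set ν : ℤ → K[X] := fun t =>
    if t < 0 then Polynomial.C (q ^ t) else Polynomial.X * Polynomial.C (q ^ t) with hν
  set E : K[X] := pairing F d fun j => hSeries ν (T j) with hE
  have hroot : ∀ v : ℕ, E.eval (q ^ v) = 0 := by
    intro v
    rw [← Polynomial.coe_aeval_eq_eval, hE, map_pairing]
    -- At X = q^v the nonnegative exponents shift by v. This preserves separation among exponents of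
    -- the same sign, which is all that the grid argument needs.
    set σ : ℤ → ℤ := fun t => if t < 0 then t else t + v with hσ
    have hσν : ∀ t, (Polynomial.aeval (q ^ v) : K[X] →ₐ[K] K) (ν t) = q ^ σ t := by
      intro t
      simp only [hν, hσ]
      split_ifs
      · simp
      · rw [map_mul, Polynomial.aeval_X, Polynomial.aeval_C, Algebra.algebraMap_self,
          RingHom.id_apply, zpow_add₀ hq0, zpow_natCast, mul_comm]
    have hσinj : Function.Injective σ := by
      intro s t hst
      simp only [hσ] at hst
      split_ifs at hst <;> omega
    simp only [map_hSeries, RingHom.coe_coe, hσν]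
    refine pairing_hSeries_eq_zero F d _ T
      (fun j => ((zpow_injective hq0 hq).comp hσinj).injOn)
      (fun j => (hd j).trans (le_card_grid m hn (hM _))) fun τ hτ => ?_
    by_contra hne
    obtain ⟨h1, h2⟩ := separated_of_eval_ne_zero hq0 hne
    refine no_separated_grid_point m hblk hcard hi hi' htM hh hh' τ (fun j => ?_)
      fun j j' hjj' hiff => ?_
    · have h3 := hτ j
      have h4 := h1 j
      simp only [hT, grid, Finset.mem_union, Finset.mem_Icc, Finset.mem_sdiff] at h3
      simp only [hσ] at h4
      rcases h3 with h3 | h3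
      · left
        rw [if_pos (by omega)] at h4
        omega
      · exact Or.inr ⟨h3.1.1, h3.1.2, h3.2⟩
    · have h3 := h2 j j' hjj'
      simp only [Separated, hσ] at h3 ⊢
      split_ifs at h3 <;> omega
  have hE0 : E = 0 := by
    refine Polynomial.eq_zero_of_infinite_isRoot E ((Set.infinite_range_of_injective
      (f := fun v : ℕ => q ^ v) fun v w hvw => ?_).mono ?_)
    · exact_mod_cast zpow_injective hq0 hq (a₁ := (v : ℤ)) (a₂ := w) (by simpa using hvw)
    · rintro _ ⟨v, rfl⟩
      exact hroot v
  have hser : ∀ j, PowerSeries.map ((Polynomial.aeval 0 : K[X] →ₐ[K] K) : K[X] →+* K)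
      (hSeries ν (T j)) = qbinSeries q (q ^ (-h : ℤ)) := by
    intro j
    rw [map_hSeries, qbinSeries_neg hq0 hq, hSeries, hSeries]
    refine (Finset.prod_subset_one_on_sdiff (Finset.subset_union_left) ?_ ?_).symm
    · intro t ht
      simp only [Finset.mem_sdiff, Finset.mem_union, Finset.mem_Icc] at ht
      have : ¬ t < 0 := by omega
      ext k
      simp [hν, this, PowerSeries.coeff_one, zero_pow_eq]
    · intro t ht
      rw [Finset.mem_Icc] at ht
      simp [hν, show t < 0 by omega]
  have h0 := congrArg (Polynomial.aeval (0 : K)) hE0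
  rw [hE, map_pairing, map_zero] at h0
  simpa only [hser] using h0

end Vanishing

/-! ### Coefficient extraction in iterated Laurent series -/

section ConstantTerm

variable {K : Type*} [Field K] {n : ℕ}

/-- The monomial `∏ (x_i / x_0) ^ e_i`. -/
noncomputable def ratioMonomial (K : Type*) [Field K] (e : Fin n → ℤ) : IterLaurent K n :=
  HahnSeries.single (toLex (Fin.cons (-∑ i, e i) e : Fin (n + 1) → ℤ)) 1

theorem ratioMonomial_add (e e' : Fin n → ℤ) :
    ratioMonomial K (e + e') = ratioMonomial K e * ratioMonomial K e' := by
  rw [ratioMonomial, ratioMonomial, ratioMonomial, HahnSeries.single_mul_single, mul_one,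
    ← toLex_add]
  refine congrArg (fun v => HahnSeries.single (toLex v) 1) (funext fun i => ?_)
  refine Fin.cases ?_ (fun j => ?_) i
  · simp [Finset.sum_add_distrib]; ring
  · simp

theorem ratioMonomial_zero : ratioMonomial K (0 : Fin n → ℤ) = 1 := by
  rw [ratioMonomial, ← HahnSeries.single_zero_one, ← toLex_zero]
  refine congrArg (fun v => HahnSeries.single (toLex v) 1) (funext fun i => ?_)
  refine Fin.cases ?_ (fun j => ?_) i <;> simp

theorem ratioMonomial_sum {ι : Type*} (s : Finset ι) (e : ι → Fin n → ℤ) :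
    ratioMonomial K (∑ i ∈ s, e i) = ∏ i ∈ s, ratioMonomial K (e i) := by
  induction s using Finset.cons_induction with
  | empty => simp [ratioMonomial_zero]
  | cons a s ha ih => rw [Finset.sum_cons, Finset.prod_cons, ratioMonomial_add, ih]

theorem ratioMonomial_nsmul (k : ℕ) (e : Fin n → ℤ) :
    ratioMonomial K (k • e) = ratioMonomial K e ^ k := by
  induction k with
  | zero => simp [ratioMonomial_zero]
  | succ k ih => rw [succ_nsmul, pow_succ, ratioMonomial_add, ih]

theorem ratioMonomial_neg (e : Fin n → ℤ) :
    ratioMonomial K (-e) = (ratioMonomial K e)⁻¹ := by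
  refine eq_inv_of_mul_eq_one_left ?_
  rw [← ratioMonomial_add, neg_add_cancel, ratioMonomial_zero]

theorem X_ne_zero (i : Fin (n + 1)) : X K i ≠ 0 :=
  HahnSeries.single_ne_zero one_ne_zero

theorem X_succ_div_X_zero (i : Fin n) :
    X K i.succ / X K 0 = ratioMonomial K (Pi.single i 1) := by
  rw [div_eq_iff (X_ne_zero _), X, X, ratioMonomial, HahnSeries.single_mul_single, mul_one,
    ← toLex_add]
  refine congrArg (fun v => HahnSeries.single (toLex v) 1) (funext fun j => ?_)
  refine Fin.cases ?_ (fun j => ?_) j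
  · simp
  · simp [Pi.single_apply]

theorem X_zero_div_X_succ (i : Fin n) :
    X K 0 / X K i.succ = ratioMonomial K (-Pi.single i 1) := by
  rw [ratioMonomial_neg, ← X_succ_div_X_zero, inv_div]

theorem coeff_ratioMonomial (e : Fin n → ℤ) (k : ℤ) :
    (ratioMonomial K e).coeff (toLex (Pi.single 0 k)) = if k = 0 ∧ e = 0 then 1 else 0 := by
  rw [ratioMonomial, HahnSeries.coeff_single]
  have : toLex (Pi.single 0 k : Fin (n + 1) → ℤ) = toLex (Fin.cons (-∑ i, e i) e) ↔
      k = 0 ∧ e = 0 := by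
    rw [toLex_inj]
    constructor
    · intro h
      have he : e = 0 := by
        ext j
        have := congrFun h j.succ
        simpa using this.symm
      refine ⟨?_, he⟩
      have := congrFun h 0
      simpa [he] using this
    · rintro ⟨rfl, rfl⟩
      ext j
      refine Fin.cases ?_ (fun j => ?_) j <;> simp
  simp only [this]

/-- All exponents of `x_0` are at least `N`. -/
def HasLowerBound (N : ℤ) (f : IterLaurent K n) : Prop :=
  ∀ γ, f.coeff γ ≠ 0 → N ≤ ofLex γ 0

theorem HasLowerBound.add {N : ℤ} {f g : IterLaurent K n} (hf : HasLowerBound N f)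
    (hg : HasLowerBound N g) : HasLowerBound N (f + g) := by
  intro γ h
  by_cases h0 : f.coeff γ = 0
  · rw [HahnSeries.coeff_add, h0, zero_add] at h
    exact hg γ h
  · exact hf γ h0

theorem HasLowerBound.mul {N N' : ℤ} {f g : IterLaurent K n} (hf : HasLowerBound N f)
    (hg : HasLowerBound N' g) : HasLowerBound (N + N') (f * g) := by
  intro γ h
  obtain ⟨α, hα, β, hβ, rfl⟩ := HahnSeries.support_mul_subset h
  exact add_le_add (hf α hα) (hg β hβ)

theorem HasLowerBound.mono {N N' : ℤ} (h : N ≤ N') {f : IterLaurent K n}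
    (hf : HasLowerBound N' f) : HasLowerBound N f := fun γ hγ => h.trans (hf γ hγ)

theorem HasLowerBound.zero (N : ℤ) : HasLowerBound N (0 : IterLaurent K n) :=
  fun _ h => absurd rfl h

theorem HasLowerBound.sum {ι : Type*} {N : ℤ} {s : Finset ι} {f : ι → IterLaurent K n}
    (hf : ∀ i ∈ s, HasLowerBound N (f i)) : HasLowerBound N (∑ i ∈ s, f i) := by
  induction s using Finset.cons_induction with
  | empty => simpa using HasLowerBound.zero N
  | cons a s ha ih =>
    rw [Finset.sum_cons]
    exact (hf a (by simp)).add (ih fun i hi => hf i (by simp [hi]))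

theorem hasLowerBound_ratioMonomial (e : Fin n → ℤ) :
    HasLowerBound (-∑ i, e i) (ratioMonomial K e) := by
  intro γ h
  rw [HahnSeries.eq_of_mem_support_single h]
  simp

theorem HasLowerBound.smul {N : ℤ} {f : IterLaurent K n} (a : K) (hf : HasLowerBound N f) :
    HasLowerBound N (a • f) := fun γ h => hf γ fun h0 => h (by simp [h0])

/-- x_0 is the most significant variable, so x_0/x_i is infinitesimal and may be substituted into
power series. -/
theorem orderTop_X_zero_div_pos (i : Fin n) :
    0 < (ratioMonomial K (-Pi.single i 1 : Fin n → ℤ)).orderTop := by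
  rw [ratioMonomial, HahnSeries.orderTop_single one_ne_zero, ← WithTop.coe_zero,
    WithTop.coe_lt_coe]
  refine ⟨0, fun j hj => absurd hj (Fin.not_lt_zero j), ?_⟩
  simp only [Pi.toLex_apply, Fin.cons_zero, Pi.neg_apply, Finset.sum_neg_distrib, neg_neg,
    Finset.sum_pi_single', Finset.mem_univ, if_true]
  exact zero_lt_one

theorem hasLowerBound_ratioMonomial_pow (i : Fin n) (k : ℕ) :
    HasLowerBound k (ratioMonomial K (-Pi.single i 1 : Fin n → ℤ) ^ k) := by
  rw [← ratioMonomial_nsmul]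
  refine (hasLowerBound_ratioMonomial _).mono ?_
  simp [← Finset.mul_sum]

theorem hasLowerBound_heval (i : Fin n) (f : PowerSeries K) :
    HasLowerBound 0 (PowerSeries.heval (ratioMonomial K (-Pi.single i 1 : Fin n → ℤ)) f) := by
  intro γ h
  rw [PowerSeries.coeff_heval] at h
  obtain ⟨k, hk⟩ : ∃ k, (HahnSeries.SummableFamily.powerSeriesFamily
      (ratioMonomial K (-Pi.single i 1 : Fin n → ℤ)) f).coeff γ k ≠ 0 := by
    by_contra! h0
    exact h (finsum_eq_zero_of_forall_eq_zero h0)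
  simp only [HahnSeries.SummableFamily.coeff_apply,
    HahnSeries.SummableFamily.powerSeriesFamily_of_orderTop_pos (orderTop_X_zero_div_pos i),
    HahnSeries.coeff_smul, smul_eq_mul] at hk
  exact (Nat.cast_nonneg k).trans
    (hasLowerBound_ratioMonomial_pow i k γ (right_ne_zero_of_mul hk))

theorem heval_eq_sum_add (i : Fin n) (f : PowerSeries K) (N : ℕ) :
    PowerSeries.heval (ratioMonomial K (-Pi.single i 1 : Fin n → ℤ)) f =
      ∑ k ∈ Finset.range N, PowerSeries.coeff k f • ratioMonomial K (k • -Pi.single i 1) +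
      ratioMonomial K (-Pi.single i 1 : Fin n → ℤ) ^ N *
        PowerSeries.heval (ratioMonomial K (-Pi.single i 1 : Fin n → ℤ))
          (PowerSeries.mk fun k => PowerSeries.coeff (N + k) f) := by
  have hX := PowerSeries.heval_X _ (orderTop_X_zero_div_pos (K := K) i)
  have h := PowerSeries.eq_X_pow_mul_shift_add_trunc N f
  nth_rewrite 1 [h]
  rw [map_add, map_mul, map_pow, hX, add_comm (_ * _)]
  congr 1
  · rw [PowerSeries.trunc_apply, Nat.Ico_zero_eq_range]
    simp only [ratioMonomial_nsmul, ← Polynomial.coeToPowerSeries.ringHom_apply, map_sum]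
    refine Finset.sum_congr rfl fun k _ => ?_
    rw [Polynomial.coeToPowerSeries.ringHom_apply, Polynomial.coe_monomial,
      PowerSeries.monomial_eq_C_mul_X_pow, map_mul, map_pow, hX, PowerSeries.heval_C,
      smul_mul_assoc, one_mul]
  · simp only [add_comm N]

theorem hasLowerBound_prod_add_sub {N : ℤ} (hN : 0 ≤ N) {ι : Type*} (s : Finset ι)
    {A B : ι → IterLaurent K n} (hA : ∀ i, HasLowerBound 0 (A i))
    (hB : ∀ i, HasLowerBound N (B i)) :
    HasLowerBound 0 (∏ i ∈ s, A i) ∧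
      ∃ R, HasLowerBound N R ∧ ∏ i ∈ s, (A i + B i) = ∏ i ∈ s, A i + R := by
  induction s using Finset.cons_induction with
  | empty =>
    refine ⟨?_, 0, HasLowerBound.zero N, by simp⟩
    simpa [ratioMonomial_zero] using hasLowerBound_ratioMonomial (K := K) (0 : Fin n → ℤ)
  | cons a s ha ih =>
    obtain ⟨h0, R, hR, h⟩ := ih
    refine ⟨?_, A a * R + B a * (∏ i ∈ s, A i + R), ?_, ?_⟩
    · rw [Finset.prod_cons]
      simpa using (hA a).mul h0
    · refine HasLowerBound.add ?_ ?_
      · simpa using (hA a).mul hR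
      · simpa using (hB a).mul (h0.add (hR.mono hN))
    · rw [Finset.prod_cons, Finset.prod_cons, h]
      ring

/-- Each series is cut at order N. The tails only contribute powers of x_0 with exponent at least N,
so the product becomes a finite sum of monomials. -/
theorem coeff_prod_heval_mul (f : Fin n → PowerSeries K) (e : Fin n → ℤ) (k : ℤ) :
    ((∏ i, PowerSeries.heval (ratioMonomial K (-Pi.single i 1 : Fin n → ℤ)) (f i)) *
        ratioMonomial K e).coeff (toLex (Pi.single 0 k)) =
      if k = 0 then ∏ i, (if 0 ≤ e i then PowerSeries.coeff (e i).toNat (f i) else 0) else 0 := by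
  -- Large enough that the tails miss x_0^k after multiplication by the monomial, and that every
  -- index e i lies below the cut.
  set N : ℕ := k.natAbs + ∑ i, (e i).natAbs + 1 with hN
  obtain ⟨-, R, hR, h⟩ := hasLowerBound_prod_add_sub (Nat.cast_nonneg (α := ℤ) N) Finset.univ
    (A := fun i => ∑ k ∈ Finset.range N,
      PowerSeries.coeff k (f i) • ratioMonomial K (k • -Pi.single i 1 : Fin n → ℤ))
    (B := fun i => ratioMonomial K (-Pi.single i 1 : Fin n → ℤ) ^ N *
        PowerSeries.heval (ratioMonomial K (-Pi.single i 1 : Fin n → ℤ))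
          (PowerSeries.mk fun k => PowerSeries.coeff (N + k) (f i)))
    (fun i => HasLowerBound.sum fun k _ => HasLowerBound.smul _
      ((hasLowerBound_ratioMonomial _).mono (by simp [← Finset.mul_sum])))
    (fun i => by simpa using (hasLowerBound_ratioMonomial_pow i N).mul (hasLowerBound_heval i _))
  simp only [← heval_eq_sum_add] at h
  have hR0 : (R * ratioMonomial K e).coeff (toLex (Pi.single 0 k)) = 0 := by
    by_contra hne
    have h1 := (hR.mul (hasLowerBound_ratioMonomial e)) _ hne
    have h2 : ∑ i, e i ≤ ∑ i, |e i| := Finset.sum_le_sum fun i _ => le_abs_self _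
    simp only [ofLex_toLex, Pi.single_eq_same] at h1
    push_cast [hN] at h1
    linarith [le_abs_self k]
  have heN : ∀ i, (e i).natAbs < N := fun i => by
    have := Finset.single_le_sum (f := fun i => (e i).natAbs) (fun _ _ => Nat.zero_le _)
      (Finset.mem_univ i)
    omega
  rw [h, add_mul, HahnSeries.coeff_add, hR0, add_zero, Finset.prod_univ_sum, Finset.sum_mul,
    HahnSeries.coeff_sum]
  have hterm : ∀ μ : Fin n → ℕ, ((∏ i, PowerSeries.coeff (μ i) (f i) •
      ratioMonomial K (μ i • -Pi.single i 1 : Fin n → ℤ)) * ratioMonomial K e).coeff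
        (toLex (Pi.single 0 k)) =
      if k = 0 then ∏ i, (if e i = μ i then PowerSeries.coeff (μ i) (f i) else 0) else 0 := by
    intro μ
    have hsum : (∑ i, μ i • -Pi.single i 1 + e : Fin n → ℤ) = fun j => e j - μ j := by
      ext j
      rw [Pi.add_apply, Finset.sum_apply]
      simp only [Pi.smul_apply, Pi.neg_apply, Pi.single_apply, smul_neg, smul_ite, smul_zero,
        Finset.sum_neg_distrib, Finset.sum_ite_eq, Finset.mem_univ, if_true, nsmul_eq_mul, mul_one]
      ring
    rw [Finset.prod_smul, ← ratioMonomial_sum, smul_mul_assoc, ← ratioMonomial_add,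
      HahnSeries.coeff_smul, hsum, coeff_ratioMonomial, Finset.prod_ite_zero]
    by_cases hk : k = 0
    · simp [hk, funext_iff, sub_eq_zero]
    · simp [hk]
  simp only [hterm]
  split_ifs with hk
  · rw [← Finset.prod_univ_sum (fun _ => Finset.range N)
      (fun i j => if e i = j then PowerSeries.coeff j (f i) else 0)]
    refine Finset.prod_congr rfl fun i _ => ?_
    have hi := heN i
    split_ifs with h0
    · rw [Finset.sum_eq_single (e i).toNat]
      · rw [if_pos (by omega)]
      · intro j _ hj
        rw [if_neg (by omega)]
      · intro hj
        rw [Finset.mem_range] at hj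
        omega
    · refine Finset.sum_eq_zero fun j _ => ?_
      rw [if_neg (by omega)]
  · simp

end ConstantTerm

/-! ### The constant term as a polynomial in q^a -/

section Expansion

variable {K : Type*} [Field K] {n : ℕ}

theorem heval_one_sub (i : Fin n) (a : K) :
    PowerSeries.heval (ratioMonomial K (-Pi.single i 1 : Fin n → ℤ))
        (1 - PowerSeries.C a * PowerSeries.X) =
      1 - ratioMonomial K (-Pi.single i 1 : Fin n → ℤ) * HahnSeries.C a := by
  rw [map_sub, map_mul, map_one, PowerSeries.heval_X _ (orderTop_X_zero_div_pos i),
    PowerSeries.heval_C, ← HahnSeries.C_mul_eq_smul, mul_one, mul_comm]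

/-- Iterating the functional equation reaches a ≥ 0 from the trivial series at a = 0. For a < 0 it
leads from a up to 0, which identifies the series as the inverse of the defining product. -/
theorem qPoch_eq_heval {q : K} (hq0 : q ≠ 0) (hq : ∀ k : ℕ, 0 < k → q ^ k ≠ 1) (a : ℤ)
    (i : Fin n) :
    qPoch (HahnSeries.C q) (X K 0 / X K i.succ) a =
      PowerSeries.heval (ratioMonomial K (-Pi.single i 1 : Fin n → ℤ)) (qbinSeries q (q ^ a)) := by
  rw [X_zero_div_X_succ]
  rcases a with z | z
  · have h := qbinSeries_mul_prod hq 1 z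
    rw [qbinSeries_one, one_mul, one_mul] at h
    rw [Int.ofNat_eq_natCast, zpow_natCast, ← h, map_prod]
    simp only [one_mul, heval_one_sub]
    simp only [qPoch, qPochNat, map_pow]
  · have h := qbinSeries_mul_prod hq (q ^ Int.negSucc z) (z + 1)
    have hz : q ^ Int.negSucc z * q ^ (z + 1) = 1 := by
      rw [zpow_negSucc, inv_mul_cancel₀ (pow_ne_zero _ hq0)]
    rw [hz, qbinSeries_one] at h
    have h' := congrArg (PowerSeries.heval (ratioMonomial K (-Pi.single i 1 : Fin n → ℤ))) h
    rw [map_mul, map_prod, map_one] at h'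
    simp only [heval_one_sub] at h'
    rw [eq_inv_of_mul_eq_one_left h']
    simp only [qPoch, qPochNat]
    congr 1
    refine Finset.prod_congr rfl fun j _ => ?_
    rw [map_mul, map_zpow₀, map_pow, mul_assoc]
    congr 4

theorem qPochNat_mul_qPochNat {F : Type*} [Field F] {q x₀ x y : F} (h₀ : x₀ ≠ 0) (hx : x ≠ 0)
    (hy : y ≠ 0) (z : ℕ) :
    qPochNat q (x / y) z * qPochNat q (q * y / x) z =
      (∏ u ∈ Finset.range z,
        (y / x₀ - q ^ u * (x / x₀)) * (x / x₀ - q ^ (u + 1) * (y / x₀))) *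
        ((x / x₀) ^ z * (y / x₀) ^ z)⁻¹ := by
  rw [qPochNat, qPochNat, ← Finset.prod_mul_distrib, ← mul_pow, ← inv_pow]
  conv_rhs => rw [← Finset.card_range z, ← Finset.prod_const, Finset.card_range]
  rw [← Finset.prod_mul_distrib]
  refine Finset.prod_congr rfl fun u _ => ?_
  field_simp
  ring

theorem prod_pow_mul_pow {F : Type*} [CommMonoid F] (z : Fin n → Fin n → ℕ) (w : Fin n → F) :
    ∏ i, ∏ j ∈ Finset.Ioi i, (w i ^ z i j * w j ^ z i j) = ∏ i, w i ^ denomExp z i := by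
  have h : ∏ i, ∏ j ∈ Finset.Ioi i, w j ^ z i j = ∏ i, ∏ j ∈ Finset.Iio i, w i ^ z j i :=
    Finset.prod_comm' (by simp)
  simp only [Finset.prod_mul_distrib, h, denomExp, pow_add, Finset.prod_pow_eq_pow_sum]

theorem prod_ratioMonomial_pow (κ : Fin n → ℕ) :
    ∏ i, ratioMonomial K (Pi.single i 1 : Fin n → ℤ) ^ κ i = ratioMonomial K fun i => (κ i : ℤ) := by
  simp only [← ratioMonomial_nsmul]
  rw [← ratioMonomial_sum]
  congr 1
  ext j
  rw [Finset.sum_apply]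
  simp [Pi.single_apply]

variable {p : ℕ}

/-- The exponent `c + ε` of the factors belonging to a pair of variables. -/
noncomputable def pairExp (m : Fin (p + 1) → ℕ) (c : ℕ) (i j : Fin (∑ l, m l)) : ℕ :=
  c + eps m (i.succ : ℕ) (j.succ : ℕ)

theorem L_eq {q : K} (hq0 : q ≠ 0) (hq : ∀ k : ℕ, 0 < k → q ^ k ≠ 1) (m : Fin (p + 1) → ℕ)
    (a : ℤ) (b c : ℕ) :
    L q m a b c =
      ∑ κ ∈ (integrandPoly q b (pairExp m c)).support, (integrandPoly q b (pairExp m c)).coeff κ •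
        ((∏ i, PowerSeries.heval (ratioMonomial K (-Pi.single i 1)) (qbinSeries q (q ^ a))) *
          ratioMonomial K fun i => (κ i : ℤ) - denomExp (pairExp m c) i) := by
  set z := pairExp m c with hz
  set w : Fin (∑ l, m l) → IterLaurent K (∑ l, m l) :=
    fun i => ratioMonomial K (Pi.single i 1) with hw
  have hF : MvPolynomial.aeval w (integrandPoly q b z) =
      (∏ i : Fin (∑ l, m l), qPochNat (HahnSeries.C q) (HahnSeries.C q * X K i.succ / X K 0) b) *
        ∏ i, ∏ j ∈ Finset.Ioi i, ∏ u ∈ Finset.range (z i j),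
          (w j - HahnSeries.C q ^ u * w i) * (w i - HahnSeries.C q ^ (u + 1) * w j) := by
    simp only [integrandPoly, map_mul, map_prod, map_sub, map_one, MvPolynomial.aeval_X,
      MvPolynomial.aeval_C, ← HahnSeries.C_eq_algebraMap, map_pow, qPochNat, hw,
      ← X_succ_div_X_zero]
    congr 1
    refine Finset.prod_congr rfl fun i _ => Finset.prod_congr rfl fun t _ => ?_
    ring
  have hL : L q m a b c =
      (∏ i, PowerSeries.heval (ratioMonomial K (-Pi.single i 1)) (qbinSeries q (q ^ a))) *
        ((∏ i, w i ^ denomExp z i)⁻¹ * MvPolynomial.aeval w (integrandPoly q b z)) := by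
    rw [hF, ← prod_pow_mul_pow, L]
    simp only [qPoch_eq_heval hq0 hq,
      qPochNat_mul_qPochNat (X_ne_zero (0 : Fin (∑ l, m l + 1))) (X_ne_zero _) (X_ne_zero _),
      X_succ_div_X_zero, Finset.prod_mul_distrib, Finset.prod_inv_distrib, hw, hz, pairExp]
    ring
  rw [hL, MvPolynomial.aeval_def, MvPolynomial.eval₂_eq', Finset.mul_sum, Finset.mul_sum]
  refine Finset.sum_congr rfl fun κ _ => ?_
  rw [← HahnSeries.C_eq_algebraMap, hw, prod_ratioMonomial_pow, prod_ratioMonomial_pow,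
    ← ratioMonomial_neg, ← HahnSeries.C_mul_eq_smul, mul_left_comm _ (HahnSeries.C _),
    mul_left_comm _ (HahnSeries.C _), ← ratioMonomial_add]
  congr 3
  ext i
  exact (sub_eq_neg_add _ _).symm

theorem D_eq_pairing {q : K} (hq0 : q ≠ 0) (hq : ∀ k : ℕ, 0 < k → q ^ k ≠ 1)
    (m : Fin (p + 1) → ℕ) (a : ℤ) (b c : ℕ) :
    D q m a b c =
      HahnSeries.C (pairing (integrandPoly q b (pairExp m c)) (denomExp (pairExp m c))
        fun _ => qbinSeries q (q ^ a)) := by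
  set z := pairExp m c
  ext k
  have h := congrArg (fun f => f.coeff (toLex (Pi.single 0 k))) (L_eq hq0 hq m a b c)
  simp only [HahnSeries.coeff_sum, HahnSeries.coeff_smul, coeff_prod_heval_mul] at h
  refine h.trans ?_
  rw [HahnSeries.C_apply, HahnSeries.coeff_single]
  split_ifs with hk
  · rw [pairing]
    refine Finset.sum_congr rfl fun κ _ => ?_
    rw [smul_eq_mul, Algebra.algebraMap_self, RingHom.id_apply]
    congr 1
    refine Finset.prod_congr rfl fun i _ => ?_
    rw [coeffSub]
    by_cases hle : denomExp z i ≤ κ i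
    · rw [if_pos hle, if_pos (sub_nonneg.2 (Nat.cast_le.2 hle))]
      congr 2
      change ((κ i : ℤ) - denomExp z i).toNat = _
      omega
    · rw [if_neg hle, if_neg]
      change ¬ 0 ≤ ((κ i : ℤ) - denomExp z i)
      omega
  · simp

/-- The polynomial in `q ^ a` which gives the constant term. -/
noncomputable def ctPoly (q : K) (b : ℕ) (z : Fin n → Fin n → ℕ) : K[X] :=
  pairing (integrandPoly q b z) (denomExp z) fun _ => PowerSeries.mk (qbinPoly q)

theorem eval_ctPoly (q x : K) (b : ℕ) (z : Fin n → Fin n → ℕ) :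
    (ctPoly q b z).eval x =
      pairing (integrandPoly q b z) (denomExp z) fun _ => qbinSeries q x := by
  rw [← Polynomial.coe_aeval_eq_eval, ctPoly, map_pairing]
  congr 1

/-- A monomial κ contributes degree at most ∑ (κ i - d i), and the total degree of the integrand
exceeds ∑ d i by at most nb. If some κ i < d i, the contribution is 0. -/
theorem natDegree_ctPoly_le (q : K) (b : ℕ) (z : Fin n → Fin n → ℕ) :
    (ctPoly q b z).natDegree ≤ n * b := by
  refine Polynomial.natDegree_sum_le_of_forall_le _ _ fun κ hκ => ?_
  refine (Polynomial.natDegree_C_mul_le _ _).trans ?_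
  by_cases h : ∀ i, denomExp z i ≤ κ i
  · refine (Polynomial.natDegree_prod_le _ _).trans
      ((Finset.sum_le_sum fun i _ => (?_ : _ ≤ κ i - denomExp z i)).trans ?_)
    · rw [coeffSub, if_pos (h i), PowerSeries.coeff_mk]
      exact natDegree_qbinPoly_le q _
    · have h1 : κ.sum (fun _ e => e) ≤ _ := MvPolynomial.le_totalDegree hκ
      rw [Finsupp.sum_fintype _ _ fun _ => rfl] at h1
      have h2 := h1.trans (totalDegree_integrandPoly_le q b z)
      have h3 : ∑ i, (κ i - denomExp z i) + ∑ i, denomExp z i = ∑ i, κ i := by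
        rw [← Finset.sum_add_distrib]
        exact Finset.sum_congr rfl fun i _ => Nat.sub_add_cancel (h i)
      omega
  · push Not at h
    obtain ⟨i, hi⟩ := h
    rw [Finset.prod_eq_zero (Finset.mem_univ i)]
    · simp
    · rw [coeffSub, if_neg (by omega)]

end Expansion

/-! ### The block of an index, and denominator exponents -/

section Blocks

variable {p : ℕ} (m : Fin (p + 1) → ℕ)

theorem sum_Iic_eq (l : Fin (p + 1)) :
    ∑ k ∈ Finset.Iic l, m k = ∑ k ∈ Finset.Iio l, m k + m l := by
  rw [← Finset.Iio_insert, Finset.sum_insert (by simp), add_comm]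

theorem sum_Iic_le_sum_Iio {l l' : Fin (p + 1)} (h : l < l') :
    ∑ k ∈ Finset.Iic l, m k ≤ ∑ k ∈ Finset.Iio l', m k :=
  Finset.sum_le_sum_of_subset fun _ hk =>
    Finset.mem_Iio.2 ((Finset.mem_Iic.1 hk).trans_lt h)

theorem exists_inBlock (i : Fin (∑ l, m l)) : ∃ l, InBlock m l ((i : ℕ) + 1) := by
  have htop : (i : ℕ) + 1 ≤
      ∑ l ∈ Finset.univ.filter fun l : Fin (p + 1) => l.1 < p + 1, m l := by
    rw [Finset.filter_true_of_mem fun l _ => l.2]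
    exact i.2
  have hex : ∃ k, (i : ℕ) + 1 ≤ ∑ l ∈ Finset.univ.filter fun l : Fin (p + 1) => l.1 < k, m l :=
    ⟨p + 1, htop⟩
  classical
  set k := Nat.find hex with hk
  have h1 := Nat.find_spec hex
  have hle : k ≤ p + 1 := Nat.find_min' hex htop
  have hpos : k ≠ 0 := by
    intro h0
    rw [← hk, h0] at h1
    simp at h1
  have h2 := Nat.find_min hex (m := k - 1) (by omega)
  refine ⟨⟨k - 1, by omega⟩, ?_, ?_⟩
  · refine lt_of_le_of_lt (Finset.sum_le_sum_of_subset fun l hl => ?_) (not_le.1 h2)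
    rw [Finset.mem_Iio, Fin.lt_def] at hl
    simpa using hl
  · refine h1.trans (Finset.sum_le_sum_of_subset fun l hl => ?_)
    rw [Finset.mem_filter] at hl
    rw [Finset.mem_Iic, Fin.le_def]
    have := hl.2
    simp only
    omega

/-- The block containing a given index. -/
noncomputable def blockOf (i : Fin (∑ l, m l)) : Fin (p + 1) :=
  (exists_inBlock m i).choose

theorem inBlock_blockOf (i : Fin (∑ l, m l)) : InBlock m (blockOf m i) ((i : ℕ) + 1) :=
  (exists_inBlock m i).choose_spec

theorem blockOf_mono : Monotone (blockOf m) := by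
  intro i j hij
  by_contra! h
  have h1 := (inBlock_blockOf m i).1
  have h2 := (inBlock_blockOf m j).2
  have h3 := sum_Iic_le_sum_Iio m h
  have h4 : (i : ℕ) ≤ j := hij
  omega

theorem InBlock.eq_blockOf {m} {l : Fin (p + 1)} {i : Fin (∑ l, m l)}
    (h : InBlock m l ((i : ℕ) + 1)) : l = blockOf m i := by
  have h' := inBlock_blockOf m i
  rcases lt_trichotomy l (blockOf m i) with hl | hl | hl
  · have h3 := sum_Iic_le_sum_Iio m hl
    have h1 := h.2
    have h2 := h'.1
    omega
  · exact hl
  · have h3 := sum_Iic_le_sum_Iio m hl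
    have h1 := h'.2
    have h2 := h.1
    omega

theorem card_blockOf_le (l : Fin (p + 1)) :
    (Finset.univ.filter fun i => blockOf m i = l).card ≤ m l := by
  have h := Finset.card_le_card_of_injOn (s := Finset.univ.filter fun i => blockOf m i = l)
    (t := Finset.Ico (∑ k ∈ Finset.Iio l, m k) (∑ k ∈ Finset.Iic l, m k)) (fun i => i.1)
    (fun i hi => ?_) Fin.val_injective.injOn
  · rwa [Nat.card_Ico, sum_Iic_eq, Nat.add_sub_cancel_left] at h
  · rw [Finset.mem_coe, Finset.mem_filter] at hi
    have h := inBlock_blockOf m i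
    rw [hi.2] at h
    rw [Finset.mem_coe, Finset.mem_Ico]
    exact ⟨Nat.lt_succ_iff.1 h.1, h.2⟩

theorem eps_eq_sameBlock (i j : Fin (∑ l, m l)) :
    eps m (i.succ : ℕ) (j.succ : ℕ) = sameBlock (blockOf m i) (blockOf m j) := by
  classical
  rw [eps, sameBlock]
  refine if_congr ?_ rfl rfl
  rw [Fin.val_succ, Fin.val_succ]
  constructor
  · rintro ⟨l, hl, hi, hj⟩
    rw [← hi.eq_blockOf, ← hj.eq_blockOf]
    exact ⟨rfl, hl⟩
  · rintro ⟨h, h0⟩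
    exact ⟨_, h0, inBlock_blockOf m i, h ▸ inBlock_blockOf m j⟩

/-- Each of the other n - 1 indices contributes c, plus 1 if it shares a nonzeroth block with i.
This is the node count that interpolation requires. -/
theorem denomExp_pairExp_lt (c : ℕ) (i : Fin (∑ l, m l)) :
    denomExp (pairExp m c) i + 1 ≤ (∑ l, m l - 1) * c + effSize m (blockOf m i) := by
  have hsymm : ∀ j, sameBlock (blockOf m j) (blockOf m i) =
      sameBlock (blockOf m i) (blockOf m j) := fun j =>
    if_congr ⟨fun h => ⟨h.1.symm, h.1 ▸ h.2⟩, fun h => ⟨h.1.symm, h.1 ▸ h.2⟩⟩ rfl rfl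
  have h1 : denomExp (pairExp m c) i =
      ∑ j ∈ Finset.univ.erase i, (c + sameBlock (blockOf m i) (blockOf m j)) := by
    have hu : Finset.univ.erase i = Finset.Ioi i ∪ Finset.Iio i := by
      ext j
      simp [lt_or_lt_iff_ne, eq_comm]
    rw [hu, Finset.sum_union (Finset.disjoint_left.2 fun j hj hj' =>
      lt_asymm (Finset.mem_Ioi.1 hj) (Finset.mem_Iio.1 hj'))]
    simp only [denomExp, pairExp, eps_eq_sameBlock, hsymm]
  have h2 : ∑ j ∈ Finset.univ.erase i, sameBlock (blockOf m i) (blockOf m j) + 1 ≤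
      effSize m (blockOf m i) := by
    rw [effSize]
    split_ifs with h0
    · rw [Finset.sum_eq_zero fun j _ => ?_]
      rw [sameBlock, if_neg (fun h => h.2 h0)]
    · refine le_trans ?_ (card_blockOf_le m (blockOf m i))
      have hle : ∑ j ∈ Finset.univ.erase i, sameBlock (blockOf m i) (blockOf m j) =
          ((Finset.univ.filter fun j => blockOf m j = blockOf m i).erase i).card := by
        rw [← Finset.filter_erase, Finset.card_filter]
        refine Finset.sum_congr rfl fun j _ => if_congr ⟨fun h => h.1.symm, fun h => ?_⟩ rfl rfl
        exact ⟨h.symm, h0⟩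
      rw [hle, Finset.card_erase_add_one (by simp)]
  rw [h1, Finset.sum_add_distrib, Finset.sum_const, Finset.card_erase_of_mem (Finset.mem_univ i),
    Finset.card_univ, Fintype.card_fin, smul_eq_mul, add_assoc]
  exact Nat.add_le_add_left h2 _

end Blocks

/-! ### The set R in terms of runs, and its cardinality -/

section Roots

variable {p : ℕ} (m : Fin (p + 1) → ℕ)

/-- The run to which position `i` belongs when the runs are as long as possible. -/
noncomputable def runOf (i : ℕ) : ℕ :=
  sInf {t | i < runStart m (t + 1)}

variable {m}

theorem runStart_eq_sum {t : ℕ} (ht : ∀ l, m l ≤ t) : runStart m t = ∑ l, m l := by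
  rw [runStart, Fin.sum_univ_succ]
  congr 1
  exact Finset.sum_congr rfl fun l _ => min_eq_left (ht _)

theorem lt_runStart_runOf {i : ℕ} (hi : i < ∑ l, m l) : i < runStart m (runOf m i + 1) := by
  refine Nat.sInf_mem (s := {t | i < runStart m (t + 1)}) ⟨∑ l, m l, ?_⟩
  rw [Set.mem_ofPred_eq, runStart_eq_sum fun l =>
    (Finset.single_le_sum (fun _ _ => Nat.zero_le _) (Finset.mem_univ l)).trans (Nat.le_succ _)]
  exact hi

theorem runStart_runOf_le (i : ℕ) : runOf m i = 0 ∨ runStart m (runOf m i) ≤ i := by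
  by_contra! h
  have := Nat.sInf_le (s := {t | i < runStart m (t + 1)}) (m := runOf m i - 1) (by
    rw [Set.mem_ofPred_eq, Nat.sub_add_cancel (Nat.pos_of_ne_zero h.1)]
    exact h.2)
  change runOf m i ≤ runOf m i - 1 at this
  omega

theorem le_runOf {i t : ℕ} (hi : i < ∑ l, m l) (h : runStart m t ≤ i) : t ≤ runOf m i := by
  by_contra! hlt
  have := runStart_mono m (show runOf m i + 1 ≤ t from hlt)
  have := lt_runStart_runOf hi
  omega

theorem runOf_lt {i t : ℕ} (ht : 0 < t) (h : i < runStart m t) : runOf m i < t := by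
  by_contra! hle
  have := runStart_mono m hle
  rcases runStart_runOf_le (m := m) i with h' | h' <;> omega

theorem runOf_mono {i i' : ℕ} (h : i ≤ i') (hi' : i' < ∑ l, m l) : runOf m i ≤ runOf m i' := by
  rcases runStart_runOf_le (m := m) i with h' | h'
  · omega
  · exact le_runOf hi' (h'.trans h)

variable {s : Equiv.Perm (Fin p)}

theorem sortedSize_succ {k : ℕ} (hk : k < p) :
    sortedSize m s (k + 1) = m (s ⟨k, hk⟩).succ := by
  simp [sortedSize, hk]

theorem sum_Icc_sortedSize (f : ℤ → ℤ) :
    ∑ k ∈ Finset.Icc 1 p, f (sortedSize m s k) = ∑ l : Fin p, f (m l.succ) := by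
  rw [← Equiv.sum_comp s fun l => f (m l.succ), ← Finset.Ico_add_one_right_eq_Icc,
    Finset.sum_Ico_eq_sum_range, Nat.add_sub_cancel, ← Fin.sum_univ_eq_sum_range]
  refine Finset.sum_congr rfl fun k _ => ?_
  rw [add_comm, sortedSize_succ k.2]

theorem sortedSize_mono (hm : ∀ l, 0 < m l) (hs : Monotone fun k : Fin p => m (s k).succ)
    {k k' : ℕ} (h : k ≤ k') (hk' : k' ≤ p) : sortedSize m s k ≤ sortedSize m s k' := by
  rcases k' with _ | k'
  · rw [Nat.le_zero.1 h]
  · rw [sortedSize_succ hk']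
    rcases k with _ | k
    · exact Nat.cast_le.2 (hm (s ⟨k', hk'⟩).succ)
    · rw [sortedSize_succ (show k < p by omega)]
      exact Nat.cast_le.2 (hs (a := ⟨k, by omega⟩) (b := ⟨k', hk'⟩) (Nat.le_of_succ_le_succ h))

/-- For t between consecutive sorted sizes, the j - 1 smallest blocks are exhausted and each of the
other p - j + 1 contributes t. -/
theorem runStart_cast (hm : ∀ l, 0 < m l) (hs : Monotone fun k : Fin p => m (s k).succ)
    {j t : ℕ} (hj : 1 ≤ j) (hjp : j ≤ p) (h1 : sortedSize m s (j - 1) ≤ t)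
    (h2 : (t : ℤ) ≤ sortedSize m s j) :
    (runStart m t : ℤ) =
      m 0 + ∑ k ∈ Finset.Ico 1 j, sortedSize m s k + ((p : ℤ) - j + 1) * t := by
  have h3 : (runStart m t : ℤ) = m 0 + ∑ k ∈ Finset.Icc 1 p, min (sortedSize m s k) t := by
    rw [sum_Icc_sortedSize fun x => min x (t : ℤ), runStart]
    push_cast
    rfl
  rw [h3, ← Finset.Ico_add_one_right_eq_Icc,
    ← Finset.sum_Ico_consecutive _ hj (show j ≤ p + 1 by omega), add_assoc]
  congr 2
  · refine Finset.sum_congr rfl fun k hk => min_eq_left ?_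
    rw [Finset.mem_Ico] at hk
    exact (sortedSize_mono hm hs (show k ≤ j - 1 by omega) (by omega)).trans h1
  · rw [Finset.sum_congr rfl fun k hk => min_eq_right ?_]
    · rw [Finset.sum_const, Nat.card_Ico, nsmul_eq_mul, Nat.cast_sub (by omega)]
      push_cast
      ring
    · rw [Finset.mem_Ico] at hk
      exact h2.trans (sortedSize_mono hm hs hk.1 (by omega))

theorem sum_cast_sub_sum_Icc {j : ℕ} (hj : 1 ≤ j) (hjp : j ≤ p + 1) :
    ∑ l, (m l : ℤ) - ∑ k ∈ Finset.Icc j p, sortedSize m s k =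
      m 0 + ∑ k ∈ Finset.Ico 1 j, sortedSize m s k := by
  have h := sum_Icc_sortedSize (m := m) (s := s) fun x => x
  rw [Fin.sum_univ_succ, ← h, ← Finset.Ico_add_one_right_eq_Icc, ← Finset.Ico_add_one_right_eq_Icc,
    ← Finset.sum_Ico_consecutive _ hj hjp]
  ring

/-- On this range `runStart m` is affine with slope p - j + 1, and the floor inverts it. -/
theorem shift_eq_runOf (hm : ∀ l, 0 < m l) (hs : Monotone fun k : Fin p => m (s k).succ)
    {j i : ℕ} (hj : 1 ≤ j) (hjp : j ≤ p) (hi : i < ∑ l, m l)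
    (h1 : sortedSize m s (j - 1) ≤ runOf m i) (h2 : (runOf m i : ℤ) < sortedSize m s j) :
    shift m s j i = runOf m i := by
  have hpos : 1 ≤ sortedSize m s (j - 1) := sortedSize_mono hm hs (Nat.zero_le _) (by omega)
  have e1 := runStart_cast hm hs hj hjp h1 h2.le
  have e2 := runStart_cast hm hs (t := runOf m i + 1) hj hjp (by push_cast; omega)
    (by push_cast; omega)
  have e3 := (runStart_runOf_le (m := m) i).resolve_left (by omega)
  have e4 := lt_runStart_runOf hi
  have hp : (0 : ℚ) < (p : ℚ) - j + 1 := by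
    have : (j : ℚ) ≤ p := by exact_mod_cast hjp
    linarith
  rw [shift, Int.floor_eq_iff, le_div_iff₀ hp, div_lt_iff₀ hp]
  have e1' : (runOf m i : ℤ) * ((p : ℤ) - j + 1) ≤
      i - m 0 - ∑ k ∈ Finset.Ico 1 j, sortedSize m s k := by
    have : (runStart m (runOf m i) : ℤ) ≤ i := by exact_mod_cast e3
    linarith
  have e2' : (i : ℤ) - m 0 - ∑ k ∈ Finset.Ico 1 j, sortedSize m s k <
      ((runOf m i : ℤ) + 1) * ((p : ℤ) - j + 1) := by
    have : (i : ℤ) < runStart m (runOf m i + 1) := by exact_mod_cast e4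
    push_cast at e2
    linarith
  exact ⟨by exact_mod_cast e1', by exact_mod_cast e2'⟩

theorem exists_sortedSize {i : ℕ} (hi : i < ∑ l, m l) (h0 : runOf m i ≠ 0) :
    ∃ j, 1 ≤ j ∧ j ≤ p ∧ sortedSize m s (j - 1) ≤ runOf m i ∧
      (runOf m i : ℤ) < sortedSize m s j := by
  have hex : ∃ j, (runOf m i : ℤ) < sortedSize m s j := by
    by_contra! hle
    have : runStart m (runOf m i) = ∑ l, m l := by
      rw [runStart, Fin.sum_univ_succ]
      congr 1
      refine Finset.sum_congr rfl fun l _ => min_eq_left ?_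
      have := hle ((s.symm l : ℕ) + 1)
      rw [sortedSize_succ (s.symm l).2] at this
      simpa using this
    have := (runStart_runOf_le (m := m) i).resolve_left h0
    omega
  classical
  have h1 := Nat.find_spec hex
  have hpos : Nat.find hex ≠ 0 := by
    intro h
    rw [h] at h1
    simp only [sortedSize] at h1
    omega
  refine ⟨Nat.find hex, by omega, ?_, ?_, h1⟩
  -- Beyond index p the default size is 0, which cannot exceed `runOf m i`.
  · by_contra! hlt
    obtain ⟨k, hk⟩ := Nat.exists_eq_succ_of_ne_zero hpos
    rw [hk] at h1 hlt
    have : ¬ k < p := by omega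
    simp only [sortedSize, this, dif_neg, not_false_eq_true] at h1
    omega
  · exact not_lt.1 (Nat.find_min hex (by omega))

/-- The range of i for R^j is `runStart m` n_{s_{j-1}} ≤ i < `runStart m` n_{s_j}, where the floor
is `runOf m i`; the sets R^0 are those with i < `runStart m 1`, where it is 0. -/
theorem R_eq (hm : ∀ l, 0 < m l) (hs : Monotone fun k : Fin p => m (s k).succ) (b c : ℕ) :
    R m s b c = ↑((Finset.range (∑ l, m l)).biUnion fun i =>
      Finset.Icc ((i : ℤ) * c + runOf m i + 1) (i * c + runOf m i + b)) := by
  have hrun1 : runStart m 1 = m 0 + p := by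
    rw [runStart, Finset.sum_congr rfl fun l _ => min_eq_right (hm (Fin.succ l))]
    simp
  have hn1 := runStart_le_sum m 1
  have hlow : ∀ j, 1 ≤ j → j ≤ p → ∃ t : ℕ, sortedSize m s (j - 1) = t ∧ 0 < t ∧
      ∑ l, (m l : ℤ) - ∑ k ∈ Finset.Icc j p, sortedSize m s k
        + ((p : ℤ) - j + 1) * sortedSize m s (j - 1) = runStart m t := by
    intro j hj hjp
    have hpos : 1 ≤ sortedSize m s (j - 1) := sortedSize_mono hm hs (Nat.zero_le _) (by omega)
    obtain ⟨t, ht⟩ := Int.eq_ofNat_of_zero_le (zero_le_one.trans hpos)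
    refine ⟨t, ht, by omega, ?_⟩
    rw [sum_cast_sub_sum_Icc hj (by omega), runStart_cast hm hs hj hjp ht.le
      (ht ▸ sortedSize_mono hm hs (by omega) hjp), ht]
  have hhigh : ∀ j, 1 ≤ j → j ≤ p → ∃ t : ℕ, sortedSize m s j = t ∧ 0 < t ∧
      ∑ l, (m l : ℤ) - ∑ k ∈ Finset.Icc (j + 1) p, sortedSize m s k
        + ((p : ℤ) - j) * sortedSize m s j - 1 = runStart m t - 1 := by
    intro j hj hjp
    have hpos : 1 ≤ sortedSize m s j := sortedSize_mono hm hs (Nat.zero_le _) hjp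
    obtain ⟨t, ht⟩ := Int.eq_ofNat_of_zero_le (zero_le_one.trans hpos)
    refine ⟨t, ht, by omega, ?_⟩
    rw [sum_cast_sub_sum_Icc (by omega) (by omega), runStart_cast hm hs hj hjp
      (ht ▸ sortedSize_mono hm hs (by omega) hjp) ht.ge, Finset.sum_Ico_succ_top hj, ht]
    ring
  ext h
  simp only [R, R0, Rj, Set.mem_union, Set.mem_iUnion, Set.mem_Icc, Finset.coe_biUnion,
    Finset.coe_Icc, exists_prop, Finset.mem_coe, Finset.mem_range]
  constructor
  · rintro (⟨i, ⟨hi0, hi⟩, hh⟩ | ⟨j, ⟨hj, hjp⟩, i, ⟨hi, hi'⟩, hh⟩)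
    · obtain ⟨k, rfl⟩ := Int.eq_ofNat_of_zero_le hi0
      have hk : k < runStart m 1 := by omega
      have : runOf m k = 0 := Nat.lt_one_iff.1 (runOf_lt one_pos hk)
      exact ⟨k, by omega, by simpa [this] using hh⟩
    · obtain ⟨t, ht, ht0, htl⟩ := hlow j hj hjp
      obtain ⟨t', ht', ht0', hth⟩ := hhigh j hj hjp
      rw [htl] at hi
      rw [hth] at hi'
      obtain ⟨k, rfl⟩ := Int.eq_ofNat_of_zero_le ((Nat.cast_nonneg _).trans hi)
      have hk := runStart_le_sum m t'
      have hkn : k < ∑ l, m l := by omega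
      have h1 : t ≤ runOf m k := le_runOf hkn (by omega)
      have h2 : runOf m k < t' := runOf_lt ht0' (by omega)
      rw [shift_eq_runOf hm hs hj hjp hkn (by omega) (by omega)] at hh
      exact ⟨k, hkn, hh⟩
  · rintro ⟨i, hi, hh⟩
    by_cases h0 : runOf m i = 0
    · left
      have := lt_runStart_runOf hi
      rw [h0, zero_add, hrun1] at this
      exact ⟨i, ⟨by omega, by omega⟩, by simpa [h0] using hh⟩
    · right
      obtain ⟨j, hj, hjp, h1, h2⟩ := exists_sortedSize (s := s) hi h0
      obtain ⟨t, ht, ht0, htl⟩ := hlow j hj hjp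
      obtain ⟨t', ht', ht0', hth⟩ := hhigh j hj hjp
      refine ⟨j, ⟨hj, hjp⟩, i, ⟨?_, ?_⟩, ?_⟩
      · rw [htl]
        have := runStart_mono m (show t ≤ runOf m i by omega)
        have := (runStart_runOf_le (m := m) i).resolve_left h0
        omega
      · rw [hth]
        have := runStart_mono m (show runOf m i + 1 ≤ t' by omega)
        have := lt_runStart_runOf hi
        omega
      · rw [shift_eq_runOf hm hs hj hjp hi h1 h2]
        exact hh

/-- Since `runOf m` is monotone, successive intervals start at least c ≥ b apart and so are
disjoint. -/
theorem encard_R (hm : ∀ l, 0 < m l) (hs : Monotone fun k : Fin p => m (s k).succ) {b c : ℕ}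
    (hbc : b ≤ c) : (R m s b c).encard = (((∑ l, m l) * b : ℕ) : ℕ∞) := by
  rw [R_eq hm hs, Set.encard_coe_eq_coe_finsetCard, Finset.card_biUnion]
  · congr 1
    rw [Finset.sum_congr rfl fun i _ => (?_ : _ = b)]
    · simp
    · rw [Int.card_Icc]
      omega
  · have key : ∀ i i', i < i' → i' < ∑ l, m l →
        (i : ℤ) * c + runOf m i + b ≤ i' * c + runOf m i' := by
      intro i i' hlt hi'
      have h1 := runOf_mono (m := m) hlt.le hi'
      have h2 : ((i : ℤ) + 1) * c ≤ i' * c :=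
        mul_le_mul_of_nonneg_right (by exact_mod_cast hlt) (Nat.cast_nonneg _)
      have h3 : (b : ℤ) ≤ c := by exact_mod_cast hbc
      have h4 : (runOf m i : ℤ) ≤ runOf m i' := by exact_mod_cast h1
      linarith
    intro i hi i' hi' hne
    rw [Finset.mem_coe, Finset.mem_range] at hi hi'
    refine Finset.disjoint_left.2 fun h hh hh' => ?_
    rw [Finset.mem_Icc] at hh hh'
    rcases lt_or_gt_of_ne hne with hlt | hlt
    · have := key i i' hlt hi'
      omega
    · have := key i' i hlt hi
      omega

end Roots

end BakerForrester

theorem mainTheorem2 {K : Type*} [Field K] (q : K) (hq0 : q ≠ 0)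
    (hq : ∀ k : ℕ, 0 < k → q ^ k ≠ 1)
    (p : ℕ) (m : Fin (p + 1) → ℕ) (hm : ∀ l, 0 < m l)
    (s : Equiv.Perm (Fin p)) (hs : Monotone fun k : Fin p => m (s k).succ)
    (b c : ℕ) :
    (∃ P : K[X], P.natDegree ≤ (∑ l, m l) * b ∧
      (∀ a : ℤ, BakerForrester.D q m a b c = HahnSeries.C (P.eval (q ^ a))) ∧
      ∀ a : ℤ, -a ∈ BakerForrester.R m s b c → P.eval (q ^ a) = 0) ∧
    (∀ a : ℤ, -a ∈ BakerForrester.R m s b c → BakerForrester.D q m a b c = 0) ∧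
    (b ≤ c → (BakerForrester.R m s b c).encard = (((∑ l, m l) * b : ℕ) : ℕ∞)) := by
  open BakerForrester in
  have hD : ∀ a : ℤ, D q m a b c = HahnSeries.C ((ctPoly q b (pairExp m c)).eval (q ^ a)) :=
    fun a => by rw [D_eq_pairing hq0 hq, eval_ctPoly]
  have hroot : ∀ a : ℤ, -a ∈ R m s b c → (ctPoly q b (pairExp m c)).eval (q ^ a) = 0 := by
    intro a ha
    rw [R_eq hm hs, Finset.mem_coe, Finset.mem_biUnion] at ha
    obtain ⟨i, hi, ha⟩ := ha
    rw [Finset.mem_range] at hi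
    rw [Finset.mem_Icc] at ha
    have hnonneg : (0 : ℤ) ≤ (i : ℤ) * c + runOf m i := by positivity
    obtain ⟨h, hh⟩ := Int.eq_ofNat_of_zero_le (show 0 ≤ -a by omega)
    obtain rfl : a = -(h : ℤ) := by omega
    have hpair : pairExp m c = fun j j' => c + sameBlock (blockOf m j) (blockOf m j') := by
      ext j j'
      rw [pairExp, eps_eq_sameBlock]
    rw [eval_ctPoly]
    have hd := denomExp_pairExp_lt m c
    have hle : ∀ l, m l ≤ ∑ l, m l := fun l =>
      Finset.single_le_sum (fun _ _ => Nat.zero_le _) (Finset.mem_univ l)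
    have hM : ∀ l, effSize m l ≤ ∑ l, m l := fun l => by
      rw [effSize]
      split_ifs
      · exact (hm 0).trans_le (hle 0)
      · exact hle l
    rw [neg_neg] at ha
    -- The cutoff M is n, which bounds all effective sizes and exceeds every run index.
    have hres := pairing_qbinSeries_eq_zero hq0 hq m (blockOf_mono m) (card_blockOf_le m)
      (denomExp (pairExp m c)) (b := b) (h := h) hd hM (runStart_runOf_le i) (lt_runStart_runOf hi)
      (runOf_lt ((hm 0).trans_le (hle 0)) (by rw [runStart_eq_sum hle]; exact hi)) ha.1 ha.2
    rwa [← hpair] at hres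
  exact ⟨⟨ctPoly q b (pairExp m c), natDegree_ctPoly_le q b _, hD, hroot⟩,
    fun a ha => by rw [hD, hroot a ha, map_zero], encard_R hm hs⟩
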